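/- Let $R$ be a commutative Noetherian ring with $1\neq 0$, let $\mathfrak b\subseteq\mathfrak a$ be ideals of $R$, and let $M$ be a finitely generated $R$-module. Write $H^i_{\mathfrak a}(M)=\varinjlim_t \operatorname{Ext}^i_R(R/\mathfrak a^t,M)$ for the local cohomology modules. For an integer $n\ge 0$, an $R$-module $L$ is *in dimension $<n$* if $\dim\operatorname{Supp}(L/N)<n$ for some finitely generated submodule $N\subseteq L$ (with $\dim\emptyset=-\infty$). With values in $\mathbb N_0\cup\{\infty\}$ and $\inf\emptyset=\infty$, put $$h_{\mathfrak a}^{\mathfrak b}(M)^n=\inf\{i\in\mathbb N_0:\ \mathfrak b^tH^i_{\mathfrak a}(M)\text{ is not in dimension}<n\text{ for all }t\},$$ $$f_{\mathfrak a}^{\mathfrak b}(M)=\inf\{i\in\mathbb N_0:\ \mathfrak b\not\subseteq\operatorname{Rad}(0:_RH^i_{\mathfrak a}(M))\},\qquad f_{\mathfrak a}(M)=\inf\{i\in\mathbb N_0:\ H^i_{\mathfrak a}(M)\text{ is not finitely generated}\},$$ $$f^k_{\mathfrak a}(M)=\inf\{f_{\mathfrak aR_{\mathfrak p}}(M_{\mathfrak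 p}):\ \mathfrak p\in\operatorname{Supp}(M/\mathfrak aM),\ \dim R/\mathfrak p\ge k\},$$ the invariants of $M_{\mathfrak p}$ being taken over $R_{\mathfrak p}$. If $\mathfrak aM\ne M$, let $\operatorname{grade}_M\mathfrak a$ be the supremum of the lengths of the $M$-regular sequences contained in $\mathfrak a$. (i) For every integer $n\ge 0$ and every $r\in\{1,\ f_{\mathfrak a}(M),\ f^1_{\mathfrak a}(M),\ f^2_{\mathfrak a}(M)\}$, $$h_{\mathfrak aR_{\mathfrak p}}^{\mathfrak bR_{\mathfrak p}}(M_{\mathfrak p})^n>r\ \text{ for all }\mathfrak p\in\operatorname{Spec}R\iff h_{\mathfrak a}^{\mathfrak b}(M)^n>r$$ (if $r=\infty$, both sides are false). (ii) If $\mathfrak aM\neq M$, then the same equivalence holds for every $n\ge 0$ with $r=\operatorname{grade}_M\mathfrak a$. In particular, $$f_{\mathfrak aR_{\mathfrak p}}^{\mathfrak bR_{\mathfrak p}}(M_{\mathfrak p})>\operatorname{grade}_M\mathfrak a\ \text{ for all }\mathfrak p\in\operatorname{Spec}R\iff f_{\mathfrak a}^{\mathfrak b}(M)>\operatorname{grade}_M\mathfrak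 a .$$ -/

import Mathlib

universe u v

noncomputable section

namespace LocalGlobal

/-- `M` is in dimension `< n`: some finitely generated submodule `N` of `M` satisfies
`dim Supp (M / N) < n` (the empty support has dimension `⊥`). -/
def InDimensionLT (R : Type u) [CommRing R] (M : Type v) [AddCommGroup M] [Module R M]
    (n : ℕ) : Prop :=
  ∃ N : Submodule R M, N.FG ∧ Module.supportDim R (M ⧸ N) < (n : WithBot ℕ∞)

section

variable {R : Type u} [CommRing R]

/-- The local cohomology module `H^i_a(M) = colim_t Ext^i_R(R / a ^ t, M)`. -/
abbrev H (a : Ideal R) (i : ℕ) (M : Type u) [AddCommGroup M] [Module R M] : Type u :=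
  (localCohomology a i).obj (ModuleCat.of R M)

/-- The invariant `h_a^b(M)^n`: the least `i` such that `b ^ t H^i_a(M)` is in dimension `< n`
for no `t`, and `⊤` if there is no such `i`. -/
def hDim (a b : Ideal R) (M : Type u) [AddCommGroup M] [Module R M] (n : ℕ) : ℕ∞ :=
  ⨅ (i : ℕ) (_ : ∀ t : ℕ, ¬ InDimensionLT R ↥(b ^ t • (⊤ : Submodule R (H a i M))) n), (i : ℕ∞)

/-- The `b`-finiteness dimension `f_a^b(M)` of `M` relative to `a`: the least `i` such that `b`
is not contained in the radical of the annihilator of `H^i_a(M)`. -/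
def bFinitenessDim (a b : Ideal R) (M : Type u) [AddCommGroup M] [Module R M] : ℕ∞ :=
  ⨅ (i : ℕ) (_ : ¬ b ≤ (Module.annihilator R (H a i M)).radical), (i : ℕ∞)

/-- The finiteness dimension `f_a(M)` of `M` relative to `a`. -/
def finitenessDim (a : Ideal R) (M : Type u) [AddCommGroup M] [Module R M] : ℕ∞ :=
  ⨅ (i : ℕ) (_ : ¬ Module.Finite R (H a i M)), (i : ℕ∞)

/-- The extension `a R_p` of `a` to the localization at `p`. -/
abbrev locIdeal (p : PrimeSpectrum R) (a : Ideal R) : Ideal (Localization.AtPrime p.asIdeal) :=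
  a.map (algebraMap R (Localization.AtPrime p.asIdeal))

/-- The localization `M_p`, a module over `R_p`. -/
abbrev locModule (p : PrimeSpectrum R) (M : Type u) [AddCommGroup M] [Module R M] : Type u :=
  LocalizedModule p.asIdeal.primeCompl M

/-- The `n`-th finiteness dimension `f^n_a(M)`: the infimum of `f_{a R_p}(M_p)` over the primes
`p` in the support of `M / a M` with `dim R / p ≥ n`. -/
def nthFinitenessDim (n : ℕ) (a : Ideal R) (M : Type u) [AddCommGroup M] [Module R M] : ℕ∞ :=
  ⨅ (p : PrimeSpectrum R)
    (_ : p ∈ Module.support R (M ⧸ (a • (⊤ : Submodule R M))) ∧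
      (n : WithBot ℕ∞) ≤ ringKrullDim (R ⧸ p.asIdeal)),
    finitenessDim (locIdeal p a) (locModule p M)

/-- `grade_M a`: the supremum of the lengths of the `M`-regular sequences in `a`. -/
def gradeOn (a : Ideal R) (M : Type u) [AddCommGroup M] [Module R M] : ℕ∞ :=
  ⨆ (rs : List R) (_ : (∀ x ∈ rs, x ∈ a) ∧ RingTheory.Sequence.IsRegular M rs),
    (rs.length : ℕ∞)

end

end LocalGlobal

end

open LocalGlobal

/-!
Every `r` in question satisfies `r ≤ f^2_a(M)`. For `i < f^2_a(M)` the module `H^i_a(M)` is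
cofinite: all `Ext^k(R/a, H^i_a(M))` are finitely generated. Induction on `i` gives this for
`k ≤ 1`; since some `a^t H^i_a(M)` has support of dimension at most one, finiteness propagates to
all `k`. Consequently, for all `i ≤ f^2_a(M)`, `Hom(R/a, H^i_a(M))` is finitely generated and
`H^i_a(M)` has only finitely many associated primes. The exponents `t` witnessing the local
conditions at these primes then have a common bound, which gives the global condition.
-/

namespace LocalGlobal

open CategoryTheory Limits Abelian Opposite

section ExtComparison

universe w

variable {R : Type*} [Ring R] {C : Type*} [Category.{w} C] [Abelian C] [Linear R C]

/-- The cochain map `Hom(Q, Y) ⟶ Hom(P, Y)` given by precomposition with `φ : P ⟶ Q`. -/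
noncomputable def precompCochainMap {P Q : ChainComplex C ℕ} (φ : P ⟶ Q) (Y : C) :
    Q.linearYonedaObj R Y ⟶ P.linearYonedaObj R Y :=
  (HomologicalComplex.unopFunctor _ _).map
    (((((linearYoneda R C).obj Y).rightOp.mapHomologicalComplex _).map φ).op)

lemma isoExt_hom_naturality [EnoughProjectives C] {X X' : C} {g : X' ⟶ X}
    {P : ProjectiveResolution X} {P' : ProjectiveResolution X'}
    (φ : ProjectiveResolution.Hom P' P g) (Y : C) (n : ℕ) :
    ((_root_.Ext R C n).map g.op).app Y ≫ (P'.isoExt n Y).hom =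
      (P.isoExt n Y).hom ≫
        HomologicalComplex.homologyMap (precompCochainMap (R := R) φ.hom Y) n := by
  let F := ((linearYoneda R C).obj Y).rightOp
  have derived := congrArg Quiver.Hom.unop
    (ProjectiveResolution.isoLeftDerivedObj_inv_naturality g P' P
      φ.hom (φ.hom_f_zero_comp_π_f_zero.trans (by simp)) F n)
  let e (Q : ChainComplex C ℕ) :=
    HomologicalComplex.homologyUnop ((F.mapHomologicalComplex (ComplexShape.down ℕ)).obj Q) n
  have homologyUnop_natural : (HomologicalComplex.homologyMap
      ((F.mapHomologicalComplex (ComplexShape.down ℕ)).map φ.hom) n).unop ≫ (e P'.complex).inv =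
        (e P.complex).inv ≫ HomologicalComplex.homologyMap (precompCochainMap φ.hom Y) n :=
    (CommSq.horiz_inv (f := e P.complex) (i := e P'.complex) ⟨congrArg Quiver.Hom.unop
      (HomologicalComplex.homologyOp_hom_naturality
        (precompCochainMap (R := R) φ.hom Y) n)⟩).w.symm
  exact (congrArg (· ≫ (e P'.complex).inv) derived).trans ((Category.assoc _ _ _).trans
    ((congrArg (_ ≫ ·) homologyUnop_natural).trans (Category.assoc _ _ _).symm))

section Resolution

variable {X : C} (P : ProjectiveResolution X) {Y : C} {n : ℕ}

/-- The morphism `P_n ⟶ Y` underlying an `n`-cocycle of the complex `Hom(P, Y)`. -/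
noncomputable def cocycleHom (c : (P.complex.linearYonedaObj R Y).cycles n) :
    P.complex.X n ⟶ Y :=
  (P.complex.linearYonedaObj R Y).iCycles n c

lemma d_comp_cocycleHom (c : (P.complex.linearYonedaObj R Y).cycles n) :
    P.complex.d (n + 1) n ≫ cocycleHom P c = 0 :=
  congr($((P.complex.linearYonedaObj R Y).iCycles_d n (n + 1)) c)

lemma cocycleHom_injective : Function.Injective (cocycleHom (R := R) (Y := Y) (n := n) P) :=
  (ModuleCat.mono_iff_injective ((P.complex.linearYonedaObj R Y).iCycles n)).1 inferInstance

lemma exists_cocycleHom_eq {f : P.complex.X n ⟶ Y} (hf : P.complex.d (n + 1) n ≫ f = 0) :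
    ∃ c : (P.complex.linearYonedaObj R Y).cycles n, cocycleHom P c = f := by
  have h := ShortComplex.exact_of_f_is_kernel
    (ShortComplex.mk _ _ ((P.complex.linearYonedaObj R Y).iCycles_d n (n + 1)))
    ((P.complex.linearYonedaObj R Y).cyclesIsKernel n (n + 1) (by simp))
  rw [ShortComplex.moduleCat_exact_iff] at h
  exact h f hf

lemma cocycleHom_toCycles (m : ℕ) (g : P.complex.X m ⟶ Y) :
    cocycleHom P ((P.complex.linearYonedaObj R Y).toCycles m n g) = P.complex.d n m ≫ g :=
  congr($((P.complex.linearYonedaObj R Y).toCycles_i m n) g)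

variable [HasExt.{w} C]

lemma extMk_eq_zero_iff_zero (f : P.complex.X 0 ⟶ Y) (hf : P.complex.d 1 0 ≫ f = 0) :
    P.extMk f 1 rfl hf = 0 ↔ f = 0 := by
  refine ⟨fun h => ?_, fun h => by subst h; simp⟩
  rw [← P.extEquivCohomologyClass.apply_eq_iff_eq,
    ProjectiveResolution.extEquivCohomologyClass_extMk,
    ProjectiveResolution.extEquivCohomologyClass_zero,
    CochainComplex.HomComplex.CohomologyClass.mk_eq_zero_iff,
    CochainComplex.HomComplex.Cocycle.toSingleMk_mem_coboundaries_iff _ _ _ _ _ 1 (by simp)] at h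
  obtain ⟨g, hg⟩ := h
  have g_eq_zero : g = 0 :=
    (CochainComplex.isZero_of_isStrictlyLE P.cochainComplex 0 1).eq_of_src _ _
  rw [g_eq_zero, comp_zero] at hg
  simpa using hg.symm

lemma smul_extMk (r : R) (f : P.complex.X n ⟶ Y) (hf : P.complex.d (n + 1) n ≫ f = 0) :
    P.extMk (r • f) (n + 1) rfl (by simp [hf]) = r • P.extMk f (n + 1) rfl hf := by
  have h := P.extMk_comp_mk₀ f (n + 1) rfl hf (r • 𝟙 Y)
  simp only [Linear.comp_smul, Category.comp_id] at h
  rw [← h, Ext.mk₀_smul]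
  simp

lemma extMk_congr {f f' : P.complex.X n ⟶ Y} (h : f = f') (hf : P.complex.d (n + 1) n ≫ f = 0) :
    P.extMk f (n + 1) rfl hf = P.extMk f' (n + 1) rfl (h ▸ hf) := by
  subst h; rfl

variable (Y n) in
/-- The map sending an `n`-cocycle of `Hom(P, Y)` to its class in `Ext^n(X, Y)`. -/
noncomputable def cyclesToExt :
    (P.complex.linearYonedaObj R Y).cycles n ⟶ ModuleCat.of R (Abelian.Ext X Y n) :=
  ModuleCat.ofHom
    { toFun := fun c => P.extMk (cocycleHom P c) (n + 1) rfl (d_comp_cocycleHom P c)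
      map_add' := fun c c' => by
        rw [P.add_extMk]
        congr 1
        exact map_add _ c c'
      map_smul' := fun r c => by
        rw [RingHom.id_apply, ← smul_extMk]
        congr 1
        exact map_smul ((P.complex.linearYonedaObj R Y).iCycles n).hom r c }

lemma cyclesToExt_surjective : Function.Surjective (cyclesToExt (R := R) P Y n) := by
  intro α
  obtain ⟨f, hf, rfl⟩ := P.extMk_surjective α (n + 1) rfl
  obtain ⟨c, rfl⟩ := exists_cocycleHom_eq (R := R) P hf
  exact ⟨c, rfl⟩

lemma cyclesToExt_eq_zero_iff (c : (P.complex.linearYonedaObj R Y).cycles n) :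
    cyclesToExt P Y n c = 0 ↔
      ∃ g, (P.complex.linearYonedaObj R Y).toCycles ((ComplexShape.up ℕ).prev n) n g = c := by
  have toCycles_eq_iff (g : P.complex.X ((ComplexShape.up ℕ).prev n) ⟶ Y) :
      (P.complex.linearYonedaObj R Y).toCycles _ n g = c ↔
        P.complex.d n _ ≫ g = cocycleHom P c := by
    rw [← cocycleHom_toCycles (R := R), (cocycleHom_injective P).eq_iff]
  refine Iff.trans ?_ (exists_congr toCycles_eq_iff).symm
  cases n with
  | zero =>
    -- `prev 0 = 0` in `ComplexShape.up ℕ`, and the differential `d 0 0` is zero.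
    refine (extMk_eq_zero_iff_zero P _ (d_comp_cocycleHom P c)).trans ?_
    simp [eq_comm]
  | succ n =>
    refine (P.extMk_eq_zero_iff _ _ rfl (d_comp_cocycleHom P c) n rfl).trans ?_
    rw [CochainComplex.prev_nat_succ]

variable (R Y n)

lemma toCycles_comp_cyclesToExt :
    (P.complex.linearYonedaObj R Y).toCycles ((ComplexShape.up ℕ).prev n) n ≫
      cyclesToExt P Y n = 0 := by
  ext g
  exact (cyclesToExt_eq_zero_iff (R := R) P _).2 ⟨g, rfl⟩

lemma exact_toCycles_cyclesToExt :
    (ShortComplex.mk _ _ (toCycles_comp_cyclesToExt R P Y n)).Exact :=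
  (ShortComplex.moduleCat_exact_iff _).2 fun c hc => (cyclesToExt_eq_zero_iff (R := R) P c).1 hc

instance : Epi (cyclesToExt (R := R) P Y n) :=
  (ModuleCat.epi_iff_surjective _).2 (cyclesToExt_surjective P)

/-- `Ext^n(X, Y)` is the `n`-th cohomology of `Hom(P, Y)`, for a projective resolution `P` of
`X`. -/
noncomputable def homologyIsoExt :
    (P.complex.linearYonedaObj R Y).homology n ≅ ModuleCat.of R (Abelian.Ext X Y n) :=
  ((P.complex.linearYonedaObj R Y).homologyIsCokernel _ n rfl).coconePointUniqueUpToIso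
    (exact_toCycles_cyclesToExt R P Y n).gIsCokernel

lemma homologyπ_comp_homologyIsoExt_hom :
    (P.complex.linearYonedaObj R Y).homologyπ n ≫ (homologyIsoExt R P Y n).hom =
      cyclesToExt P Y n :=
  IsColimit.comp_coconePointUniqueUpToIso_hom
    ((P.complex.linearYonedaObj R Y).homologyIsCokernel _ n rfl)
    (exact_toCycles_cyclesToExt R P Y n).gIsCokernel WalkingParallelPair.one

end Resolution

end ExtComparison

section DerivedExt

universe w

variable (R : Type*) [CommRing R] {C : Type*} [Category.{w} C] [Abelian C] [Linear R C]
  [EnoughProjectives C] [HasExt.{w} C]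

/-- Mathlib's two constructions of `Ext` agree: the left derived functors of `Hom(-, Y)` used for
local cohomology, and the shifted homs in the derived category, which carry the long exact
sequences. -/
noncomputable def derivedExtIso (X Y : C) (n : ℕ) :
    ((_root_.Ext R C n).obj (op X)).obj Y ≅ ModuleCat.of R (Abelian.Ext X Y n) :=
  (projectiveResolution X).isoExt n Y ≪≫ homologyIsoExt R (projectiveResolution X) Y n

/-- The map `Ext^n(X, Y) ⟶ Ext^n(X', Y)` given by precomposition with `g : X' ⟶ X`. -/
noncomputable def extPrecomp {X X' : C} (g : X' ⟶ X) (Y : C) (n : ℕ) :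
    ModuleCat.of R (Abelian.Ext X Y n) ⟶ ModuleCat.of R (Abelian.Ext X' Y n) :=
  ModuleCat.ofHom ((Abelian.Ext.mk₀ g).precompOfLinear R Y (zero_add n))

lemma derivedExtIso_naturality {X X' : C} (g : X' ⟶ X) (Y : C) (n : ℕ) :
    ((_root_.Ext R C n).map g.op).app Y ≫ (derivedExtIso R X' Y n).hom =
      (derivedExtIso R X Y n).hom ≫ extPrecomp R g Y n := by
  let φ : ProjectiveResolution.Hom (projectiveResolution X') (projectiveResolution X) g :=
    ⟨ProjectiveResolution.lift g _ _,
      (ProjectiveResolution.lift_commutes_zero g _ _).trans (by simp)⟩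
  have cocycleHom_map (c : ((projectiveResolution X).complex.linearYonedaObj R Y).cycles n) :
      cocycleHom (projectiveResolution X')
          (HomologicalComplex.cyclesMap (precompCochainMap φ.hom Y) n c) =
        φ.hom.f n ≫ cocycleHom (projectiveResolution X) c :=
    congr($(HomologicalComplex.cyclesMap_i (precompCochainMap φ.hom Y) n) c)
  dsimp only [derivedExtIso, Iso.trans_hom]
  rw [reassoc_of% isoExt_hom_naturality φ Y n, Category.assoc]
  congr 1
  rw [← cancel_epi (HomologicalComplex.homologyπ _ n),
    HomologicalComplex.homologyπ_naturality_assoc, homologyπ_comp_homologyIsoExt_hom,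
    reassoc_of% homologyπ_comp_homologyIsoExt_hom R (projectiveResolution X)]
  ext c
  exact (extMk_congr _ (cocycleHom_map c) (d_comp_cocycleHom _ _)).trans
    (ProjectiveResolution.mk₀_comp_extMk (cocycleHom _ c) (n + 1) rfl
      (d_comp_cocycleHom _ c) φ).symm

end DerivedExt

section PowTorsion

variable {R : Type*} [CommRing R] {M : Type*} [AddCommGroup M] [Module R M]

lemma mem_primaryComponent_iff {a : Ideal R} {m : M} :
    m ∈ a.primaryComponent M ↔ ∃ t : ℕ, ∀ x ∈ a ^ t, x • m = 0 := by
  simp [Ideal.primaryComponent_mem]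

/-- `M` is `a`-power torsion, that is, `Γ_a(M) = M`: every element is killed by a power of `a`. -/
def IsPowTorsion (a : Ideal R) (M : Type*) [AddCommGroup M] [Module R M] : Prop :=
  ∀ m : M, ∃ t : ℕ, ∀ x ∈ a ^ t, x • m = 0

lemma isPowTorsion_primaryComponent (a : Ideal R) (M : Type*) [AddCommGroup M] [Module R M] :
    IsPowTorsion a (a.primaryComponent M) := fun ⟨_, hm⟩ =>
  (mem_primaryComponent_iff.1 hm).imp fun _ ht x hx => Subtype.ext (ht x hx)

/-- The linear maps `R ⧸ I → M` are the elements of `M` killed by `I`, via evaluation at `1`. -/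
def quotHomEquiv (I : Ideal R) (M : Type*) [AddCommGroup M] [Module R M] :
    (R ⧸ I →ₗ[R] M) ≃ₗ[R] Submodule.torsionBySet R M I where
  toFun f := ⟨f 1, (Submodule.mem_torsionBySet_iff _ _).2 fun x => by
    rw [← map_smul, Algebra.smul_def, mul_one, Ideal.Quotient.algebraMap_eq,
      Ideal.Quotient.eq_zero_iff_mem.2 x.2, map_zero]⟩
  map_add' _ _ := rfl
  map_smul' _ _ := rfl
  invFun m := Submodule.liftQ I (LinearMap.toSpanSingleton R M m) fun x hx =>
    (Submodule.mem_torsionBySet_iff _ _).1 m.2 ⟨x, hx⟩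
  left_inv f := by
    ext
    exact one_smul R (f 1)
  right_inv m := Subtype.ext (one_smul R m.1)

end PowTorsion

section FilteredColimit

universe w

variable {R : Type*} [Ring R] {J : Type*} [Category* J] {F G K : J ⥤ ModuleCat.{w} R}
  [PreservesColimitsOfShape J (forget (ModuleCat.{w} R))]

lemma surjective_isColimitMap {c : Cocone F} (hc : IsColimit c) {d : Cocone G} (hd : IsColimit d)
    {α : F ⟶ G} (h : ∀ j, Function.Surjective (α.app j)) : Function.Surjective (hc.map d α) := by
  intro y
  obtain ⟨j, y, rfl⟩ := Concrete.isColimit_exists_rep _ hd y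
  obtain ⟨x, rfl⟩ := h j y
  exact ⟨c.ι.app j x, congr($(IsColimit.ι_map hc d α j) x)⟩

variable [IsFiltered J]

/-- A cocone of injective, jointly surjective maps over a filtered diagram of modules is a
colimit. -/
noncomputable def isColimitOfInjective [HasColimit F] (c : Cocone F)
    (inj : ∀ j, Function.Injective (c.ι.app j)) (surj : ∀ x : c.pt, ∃ j y, c.ι.app j y = x) :
    IsColimit c :=
  have desc_ι (j : J) (y : F.obj j) : colimit.desc F c (colimit.ι F j y) = c.ι.app j y :=
    congr($(colimit.ι_desc c j) y)
  have : IsIso ((colimit.isColimit F).desc c) := by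
    change IsIso (colimit.desc F c)
    rw [ConcreteCategory.isIso_iff_bijective]
    refine ⟨(injective_iff_map_eq_zero (colimit.desc F c).hom).2 fun z hz => ?_, fun x => ?_⟩
    · obtain ⟨j, y, rfl⟩ := Concrete.colimit_exists_rep _ z
      have y_eq_zero : y = 0 := inj j (((desc_ι j y).symm.trans hz).trans (map_zero _).symm)
      rw [y_eq_zero, map_zero]
    · obtain ⟨j, y, rfl⟩ := surj x
      exact ⟨_, desc_ι j y⟩
  IsColimit.ofPointIso (colimit.isColimit F)

lemma exact_isColimitMap {c : Cocone F} (hc : IsColimit c) {d : Cocone G} (hd : IsColimit d)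
    {e : Cocone K} (he : IsColimit e) {α : F ⟶ G} {β : G ⟶ K}
    (h : ∀ j, Function.Exact (α.app j) (β.app j)) :
    Function.Exact (hc.map d α) (hd.map e β) := by
  have map_ι (j : J) (x : F.obj j) : hc.map d α (c.ι.app j x) = d.ι.app j (α.app j x) :=
    congr($(IsColimit.ι_map hc d α j) x)
  have map_ι' (j : J) (y : G.obj j) : hd.map e β (d.ι.app j y) = e.ι.app j (β.app j y) :=
    congr($(IsColimit.ι_map hd e β j) y)
  intro y
  constructor
  · obtain ⟨j, y, rfl⟩ := Concrete.isColimit_exists_rep _ hd y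
    intro hy
    obtain ⟨k, w, w', hw⟩ := Concrete.isColimit_exists_of_rep_eq _ he (β.app j y) 0
      (((map_ι' j y).symm.trans hy).trans (map_zero (e.ι.app j).hom).symm)
    obtain ⟨x, hx⟩ := (h k (G.map w y)).1
      (congr($(β.naturality w) y).trans (hw.trans (map_zero (K.map w').hom)))
    exact ⟨c.ι.app k x, ((map_ι k x).trans congr(d.ι.app k $hx)).trans congr($(d.w w) y)⟩
  · rintro ⟨x, rfl⟩
    obtain ⟨j, x, rfl⟩ := Concrete.isColimit_exists_rep _ hc x
    rw [map_ι, map_ι', (h j).apply_apply_eq_zero, map_zero]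

end FilteredColimit

section ExtSystem

variable {R : Type u} [CommRing R]

lemma smul_ext_eq_zero {X Y : ModuleCat.{u} R} {x : R} (hx : x ∈ Module.annihilator R X) {n : ℕ}
    (ξ : Abelian.Ext X Y n) : x • ξ = 0 := by
  have smul_id : x • 𝟙 X = 0 := by
    ext m
    exact Module.mem_annihilator.1 hx m
  rw [← Ext.mk₀_id_comp ξ, ← Ext.smul_comp, ← Ext.mk₀_smul, smul_id, Ext.mk₀_zero, Ext.zero_comp]

/-- `Ext⁰(R ⧸ I, Y)` consists of the elements of `Y` killed by `I`. -/
noncomputable def extZeroEquiv (I : Ideal R) (Y : ModuleCat.{u} R) :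
    Abelian.Ext (ModuleCat.of R (R ⧸ I)) Y 0 ≃ₗ[R] Submodule.torsionBySet R Y I :=
  Ext.linearEquiv₀.trans (ModuleCat.homLinearEquiv.trans (quotHomEquiv I Y))

lemma extZeroEquiv_mk₀ {I : Ideal R} {Y : ModuleCat.{u} R} (f : ModuleCat.of R (R ⧸ I) ⟶ Y) :
    (extZeroEquiv I Y (Ext.mk₀ f) : Y) = f (1 : R ⧸ I) :=
  congr($((Ext.linearEquiv₀ (R := R)).apply_symm_apply f) (1 : R ⧸ I))

/-- The inverse system of the modules `R ⧸ a ^ t`. -/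
noncomputable abbrev quotPowSystem (a : Ideal R) : ℕᵒᵖ ⥤ ModuleCat.{u} R :=
  localCohomology.ringModIdeals (localCohomology.idealPowersDiagram a)

/-- The direct system of the modules `Ext^n(R ⧸ a ^ t, Y)`. -/
noncomputable def extSystem (a : Ideal R) (Y : ModuleCat.{u} R) (n : ℕ) :
    ℕᵒᵖᵒᵖ ⥤ ModuleCat.{u} R where
  obj t := ModuleCat.of R (Abelian.Ext ((quotPowSystem a).obj t.unop) Y n)
  map w := extPrecomp R ((quotPowSystem a).map w.unop) Y n
  map_id t := by
    ext α
    simp [extPrecomp]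
  map_comp v w := by
    ext α
    simp [extPrecomp]

/-- Mathlib's direct system defining local cohomology, evaluated at `Y`, is the system of the
modules `Ext^n(R ⧸ a ^ t, Y)` of the derived category. -/
noncomputable def diagramEvaluationIso (a : Ideal R) (Y : ModuleCat.{u} R) (n : ℕ) :
    localCohomology.diagram (localCohomology.idealPowersDiagram a) n ⋙ (evaluation _ _).obj Y ≅
      extSystem a Y n :=
  NatIso.ofComponents (fun t => derivedExtIso R ((quotPowSystem a).obj t.unop) Y n)
    fun w => derivedExtIso_naturality R ((quotPowSystem a).map w.unop) Y n

/-- The maps `Ext^n(R ⧸ a ^ t, Y) → H^n_a(Y)`. -/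
noncomputable def localCohomologyCocone (a : Ideal R) (Y : ModuleCat.{u} R) (n : ℕ) :
    Cocone (extSystem a Y n) :=
  have := localCohomology.hasColimitDiagram.{u, 0} (localCohomology.idealPowersDiagram a) n
  (Cocone.precompose (diagramEvaluationIso a Y n).inv).obj
    (((evaluation _ _).obj Y).mapCocone (colimit.cocone _))

/-- `H^n_a(Y)` is the colimit of the modules `Ext^n(R ⧸ a ^ t, Y)`. -/
noncomputable def isColimitLocalCohomologyCocone (a : Ideal R) (Y : ModuleCat.{u} R) (n : ℕ) :
    IsColimit (localCohomologyCocone a Y n) :=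
  have := localCohomology.hasColimitDiagram.{u, 0} (localCohomology.idealPowersDiagram a) n
  (IsColimit.precomposeInvEquiv (diagramEvaluationIso a Y n) _).symm
    (isColimitOfPreserves ((evaluation _ _).obj Y) (colimit.isColimit _))

instance : PreservesColimitsOfShape ℕᵒᵖᵒᵖ (forget (ModuleCat.{u} R)) :=
  have : PreservesFilteredColimitsOfSize.{0, 0} (forget (ModuleCat.{u} R)) :=
    preservesFilteredColimitsOfSize_shrink.{0, u, 0, u} _
  inferInstance

/-- The maps `Ext⁰(R ⧸ a ^ t, Y) → Γ_a(Y)`. -/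
noncomputable def primaryComponentCocone (a : Ideal R) (Y : ModuleCat.{u} R) :
    Cocone (extSystem a Y 0) where
  pt := ModuleCat.of R (a.primaryComponent Y)
  ι.app t := ModuleCat.ofHom ((Submodule.inclusion
    (le_iSup (fun n : ℕ => Submodule.torsionBySet R Y ↑(a ^ n)) t.unop.unop)).comp
      (extZeroEquiv (a ^ t.unop.unop) Y).toLinearMap)
  ι.naturality t s w := by
    ext α
    obtain ⟨f, rfl⟩ := (Ext.mk₀_bijective _ _).2 α
    have map_mk₀ : (extSystem a Y 0).map w (Ext.mk₀ f) =
        Ext.mk₀ ((quotPowSystem a).map w.unop ≫ f) := Ext.mk₀_comp_mk₀ _ _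
    refine Subtype.ext ?_
    change (extZeroEquiv _ Y ((extSystem a Y 0).map w (Ext.mk₀ f)) : Y) =
      extZeroEquiv _ Y (Ext.mk₀ f)
    rw [map_mk₀]
    exact (extZeroEquiv_mk₀ _).trans (extZeroEquiv_mk₀ f).symm

/-- `Γ_a(Y)` is the colimit of the modules `Ext⁰(R ⧸ a ^ t, Y)`. -/
noncomputable def isColimitPrimaryComponentCocone (a : Ideal R) (Y : ModuleCat.{u} R) :
    IsColimit (primaryComponentCocone a Y) :=
  isColimitOfInjective _
    (fun t => (Submodule.inclusion_injective (le_iSup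
      (fun n : ℕ => Submodule.torsionBySet R Y ↑(a ^ n)) t.unop.unop)).comp
        (extZeroEquiv (a ^ t.unop.unop) Y).injective)
    fun y => by
      obtain ⟨t, ht⟩ := (Ideal.primaryComponent_mem _ _ _).1 y.2
      refine ⟨op (op t), (extZeroEquiv (a ^ t) Y).symm ⟨y.1, ht⟩, ?_⟩
      have := congrArg Subtype.val ((extZeroEquiv (a ^ t) Y).apply_symm_apply ⟨y.1, ht⟩)
      exact Subtype.ext this

variable (a : Ideal R)

/-- The map of direct systems `Ext^n(R ⧸ a ^ t, Y) → Ext^n(R ⧸ a ^ t, Y')` induced by `g`. -/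
noncomputable def extSystemMap {Y Y' : ModuleCat.{u} R} (g : Y ⟶ Y') (n : ℕ) :
    extSystem a Y n ⟶ extSystem a Y' n where
  app t := ModuleCat.ofHom ((Ext.mk₀ g).postcompOfLinear R _ (add_zero n))
  naturality t s w := by
    ext α
    exact Ext.comp_assoc _ _ _ (zero_add n) (add_zero n) (by lia)

section ShortExact

variable {S : ShortComplex (ModuleCat.{u} R)} (hS : S.ShortExact)

/-- The connecting map of direct systems `Ext^n(R ⧸ a ^ t, X₃) → Ext^{n+1}(R ⧸ a ^ t, X₁)`. -/
noncomputable def connecting (n : ℕ) : extSystem a S.X₃ n ⟶ extSystem a S.X₁ (n + 1) where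
  app t := ModuleCat.ofHom (hS.extClass.postcompOfLinear R _ rfl)
  naturality t s w := by
    ext α
    exact Ext.comp_assoc _ _ _ (zero_add n) rfl (by lia)

lemma exact_extSystemMap_connecting (n : ℕ) (t : ℕᵒᵖᵒᵖ) :
    Function.Exact ((extSystemMap a S.g n).app t) ((connecting a hS n).app t) := fun α =>
  ⟨fun hα => Ext.covariant_sequence_exact₃ _ hS α rfl hα, by
    rintro ⟨β, rfl⟩
    have comp_comp_eq_zero {X : ModuleCat.{u} R} (β : Abelian.Ext X S.X₂ n) :
        (β.comp (Ext.mk₀ S.g) (add_zero n)).comp hS.extClass rfl = 0 := by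
      rw [Ext.comp_assoc_of_second_deg_zero, hS.comp_extClass, Ext.comp_zero]
    exact comp_comp_eq_zero β⟩

variable [Injective S.X₂]

lemma connecting_surjective (n : ℕ) (t : ℕᵒᵖᵒᵖ) :
    Function.Surjective ((connecting a hS n).app t) :=
  fun α => Ext.covariant_sequence_exact₁ _ hS α (Ext.eq_zero_of_injective _) rfl

lemma isIso_connecting_succ (n : ℕ) : IsIso (connecting a hS (n + 1)) := by
  have (t : ℕᵒᵖᵒᵖ) : IsIso ((connecting a hS (n + 1)).app t) := by
    rw [ConcreteCategory.isIso_iff_bijective]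
    refine ⟨(injective_iff_map_eq_zero ((connecting a hS (n + 1)).app t).hom).2 fun α hα => ?_,
      connecting_surjective a hS _ t⟩
    obtain ⟨β, rfl⟩ := Ext.covariant_sequence_exact₃ _ hS α rfl hα
    rw [Ext.eq_zero_of_injective β, Ext.zero_comp]
    rfl
  exact NatIso.isIso_of_isIso_app _

end ShortExact

end ExtSystem

section LocalCohomology

variable {R : Type u} [CommRing R] {M E C : Type u} [AddCommGroup M] [Module R M]
  [AddCommGroup E] [Module R E] [AddCommGroup C] [Module R C]

theorem isPowTorsion_localCohomology (a : Ideal R) (i : ℕ) (M : Type u) [AddCommGroup M]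
    [Module R M] : IsPowTorsion a (H a i M) := by
  intro z
  obtain ⟨t, ξ, rfl⟩ := Concrete.isColimit_exists_rep _
    (isColimitLocalCohomologyCocone a (ModuleCat.of R M) i) z
  refine ⟨t.unop.unop, fun x hx => ?_⟩
  have smul_ξ : x • ξ = 0 := smul_ext_eq_zero (Ideal.annihilator_quotient.ge hx) ξ
  let φ := ((localCohomologyCocone a (ModuleCat.of R M) i).ι.app t).hom
  exact (map_smul φ x ξ).symm.trans ((congrArg φ smul_ξ).trans (map_zero φ))

/-- `H⁰_a(M) = Γ_a(M)`. -/
noncomputable def localCohomologyZeroEquiv (a : Ideal R) (M : Type u) [AddCommGroup M]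
    [Module R M] : H a 0 M ≃ₗ[R] a.primaryComponent M :=
  ((isColimitLocalCohomologyCocone a (ModuleCat.of R M) 0).coconePointUniqueUpToIso
    (isColimitPrimaryComponentCocone a (ModuleCat.of R M))).toLinearEquiv

variable (a : Ideal R) [Module.Injective R E] {f : M →ₗ[R] E} {g : E →ₗ[R] C}
  (hf : Function.Injective f) (hfg : Function.Exact f g) (hg : Function.Surjective g)

include hf hfg hg

theorem exists_exact_primaryComponent_map : ∃ φ : a.primaryComponent C →ₗ[R] H a 1 M,
    Function.Exact (Ideal.primaryComponent.map a g) φ ∧ Function.Surjective φ := by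
  let S := ShortComplex.moduleCatMk f g hfg.linearMap_comp_eq_zero
  have hS : S.ShortExact := ModuleCat.shortComplex_shortExact S hfg hf hg
  have : Injective S.X₂ := Module.injective_object_of_injective_module R E
  let h₂ := isColimitPrimaryComponentCocone a S.X₂
  let h₃ := isColimitPrimaryComponentCocone a S.X₃
  let h₁ := isColimitLocalCohomologyCocone a S.X₁ 1
  have map_eq : h₂.map (primaryComponentCocone a S.X₃) (extSystemMap a S.g 0) =
      ModuleCat.ofHom (Ideal.primaryComponent.map a g) := by
    refine h₂.hom_ext fun t => (IsColimit.ι_map _ _ _ _).trans ?_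
    ext α
    obtain ⟨k, rfl⟩ := (Ext.mk₀_bijective _ _).2 α
    have map_mk₀ : (extSystemMap a S.g 0).app t (Ext.mk₀ k) = Ext.mk₀ (k ≫ S.g) :=
      Ext.mk₀_comp_mk₀ _ _
    refine Subtype.ext ?_
    change (extZeroEquiv _ S.X₃ ((extSystemMap a S.g 0).app t (Ext.mk₀ k))).1 =
      g (extZeroEquiv _ S.X₂ (Ext.mk₀ k)).1
    rw [map_mk₀]
    exact (extZeroEquiv_mk₀ _).trans (congrArg g (extZeroEquiv_mk₀ k)).symm
  refine ⟨(h₃.map (localCohomologyCocone a S.X₁ 1) (connecting a hS 0)).hom, ?_,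
    surjective_isColimitMap _ h₁ (connecting_surjective a hS 0)⟩
  have := exact_isColimitMap h₂ h₃ h₁ (exact_extSystemMap_connecting a hS 0)
  rwa [map_eq] at this

theorem nonempty_localCohomology_succ_equiv (i : ℕ) :
    Nonempty (H a (i + 2) M ≃ₗ[R] H a (i + 1) C) := by
  let S := ShortComplex.moduleCatMk f g hfg.linearMap_comp_eq_zero
  have hS : S.ShortExact := ModuleCat.shortComplex_shortExact S hfg hf hg
  have : Injective S.X₂ := Module.injective_object_of_injective_module R E
  have := isIso_connecting_succ a hS i
  exact ⟨((isColimitLocalCohomologyCocone a S.X₃ (i + 1)).coconePointsIsoOfNatIso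
    (isColimitLocalCohomologyCocone a S.X₁ (i + 2))
      (asIso (connecting a hS (i + 1)))).toLinearEquiv.symm⟩

end LocalCohomology

section Injective

lemma exists_shortExact_injective (R : Type u) [CommRing R] (M : Type u) [AddCommGroup M]
    [Module R M] :
    ∃ (E C : ModuleCat.{u} R) (f : M →ₗ[R] E) (g : E →ₗ[R] C), Module.Injective R E ∧
      Function.Injective f ∧ Function.Exact f g ∧ Function.Surjective g :=
  ⟨Injective.under (ModuleCat.of R M), ModuleCat.of R (_ ⧸ LinearMap.range
      (Injective.ι (ModuleCat.of R M)).hom), _, Submodule.mkQ _,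
    (Module.injective_iff_injective_object R _).2 (Injective.injective_under (ModuleCat.of R M)),
    (ModuleCat.mono_iff_injective _).1 (Injective.ι_mono _), LinearMap.exact_map_mkQ_range _,
    Submodule.mkQ_surjective _⟩

variable {R : Type u} [CommRing R] {a : Ideal R}

lemma exists_pow_smul_eq_zero_of_fg {M : Type*} [AddCommGroup M] [Module R M] {N : Submodule R M}
    (hN : N.FG) (h : N ≤ a.primaryComponent M) : ∃ t : ℕ, ∀ x ∈ a ^ t, ∀ m ∈ N, x • m = 0 := by
  induction N, hN using Submodule.fg_induction with
  | singleton m =>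
    obtain ⟨t, ht⟩ := mem_primaryComponent_iff.1 (h (Submodule.mem_span_singleton_self m))
    refine ⟨t, fun x hx m' hm' => ?_⟩
    obtain ⟨r, rfl⟩ := Submodule.mem_span_singleton.1 hm'
    rw [smul_comm, ht x hx, smul_zero]
  | sup N₁ N₂ _ _ h₁ h₂ =>
    obtain ⟨t₁, ht₁⟩ := h₁ (le_sup_left.trans h)
    obtain ⟨t₂, ht₂⟩ := h₂ (le_sup_right.trans h)
    refine ⟨max t₁ t₂, fun x hx m hm => ?_⟩
    obtain ⟨m₁, hm₁, m₂, hm₂, rfl⟩ := Submodule.mem_sup.1 hm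
    rw [smul_add, ht₁ x (Ideal.pow_le_pow_right (le_max_left _ _) hx) _ hm₁,
      ht₂ x (Ideal.pow_le_pow_right (le_max_right _ _) hx) _ hm₂, add_zero]

variable [IsNoetherianRing R]

-- By Artin–Rees, `I ∩ a ^ m ⊆ a ^ t I` for large `m`.
lemma exists_pow_inf_le_ker {N : Type*} [AddCommGroup N] [Module R N] (hN : IsPowTorsion a N)
    {I : Ideal R} (g : I →ₗ[R] N) : ∃ m : ℕ, ∀ y : I, (y : R) ∈ a ^ m → g y = 0 := by
  obtain ⟨t, ht⟩ := exists_pow_smul_eq_zero_of_fg (Module.Finite.iff_fg.1 inferInstance)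
    (fun n _ => mem_primaryComponent_iff.2 (hN n) : LinearMap.range g ≤ a.primaryComponent N)
  obtain ⟨k, hk⟩ := a.exists_pow_inf_eq_pow_smul (M := R) I
  have le_map_ker : a ^ t • I ≤ (LinearMap.ker g).map I.subtype :=
    Submodule.smul_le.2 fun x hx y hy => ⟨x • ⟨y, hy⟩,
      (map_smul g x _).trans (ht x hx _ (LinearMap.mem_range_self g ⟨y, hy⟩)), rfl⟩
  refine ⟨k + t, fun y hy => ?_⟩
  have hy' : (y : R) ∈ a ^ (k + t) • (⊤ : Ideal R) ⊓ I := ⟨by simpa using hy, y.2⟩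
  rw [hk _ (Nat.le_add_right _ _), Nat.add_sub_cancel_left] at hy'
  obtain ⟨z, hz, hzy⟩ := le_map_ker (Submodule.smul_mono le_rfl inf_le_right hy')
  exact Subtype.ext hzy ▸ hz

theorem injective_primaryComponent (a : Ideal R) (E : Type u) [AddCommGroup E] [Module R E]
    [Module.Injective R E] : Module.Injective R (a.primaryComponent E) := by
  refine Module.Baer.injective fun I g => ?_
  obtain ⟨m, hm⟩ := exists_pow_inf_le_ker (isPowTorsion_primaryComponent a E) g
  let q : I →ₗ[R] R ⧸ a ^ m := (Submodule.mkQ (a ^ m)).comp I.subtype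
  have ker_q_le : LinearMap.ker q ≤ LinearMap.ker ((a.primaryComponent E).subtype.comp g) :=
    fun y hy => congrArg Subtype.val (hm y ((Submodule.Quotient.mk_eq_zero _).1 hy))
  obtain ⟨G, hG⟩ := Module.Injective.extension_property R E _ _ ((LinearMap.ker q).liftQ q le_rfl)
    (LinearMap.ker_eq_bot.1 (Submodule.ker_liftQ_eq_bot _ _ _ le_rfl))
    ((LinearMap.ker q).liftQ _ ker_q_le)
  have G_mem (z : R ⧸ a ^ m) : G z ∈ a.primaryComponent E := by
    refine mem_primaryComponent_iff.2 ⟨m, fun x hx => ?_⟩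
    rw [← map_smul, Module.mem_annihilator.1 (Ideal.annihilator_quotient.ge hx) z, map_zero]
  exact ⟨(G.codRestrict _ G_mem).comp (Submodule.mkQ (a ^ m)), fun x hx =>
    Subtype.ext (LinearMap.congr_fun hG (Submodule.Quotient.mk ⟨x, hx⟩))⟩

end Injective

section Localization

variable {R : Type*} [CommRing R] (S : Submonoid R) {M : Type*} [AddCommGroup M] [Module R M]

lemma localizedModule_mk_eq_zero_iff {m : M} {s : S} :
    LocalizedModule.mk m s = 0 ↔ ∃ u ∈ S, u • m = 0 := by
  rw [← LocalizedModule.zero_mk 1, LocalizedModule.mk_eq]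
  simp [Submonoid.smul_def]

lemma exists_smul_eq_zero_of_fg {N : Submodule R M} (hN : N.FG)
    (h : ∀ m ∈ N, ∃ u ∈ S, u • m = 0) : ∃ u ∈ S, ∀ m ∈ N, u • m = 0 := by
  induction N, hN using Submodule.fg_induction with
  | singleton m =>
    obtain ⟨u, hu, h⟩ := h m (Submodule.mem_span_singleton_self m)
    refine ⟨u, hu, fun m' hm' => ?_⟩
    obtain ⟨r, rfl⟩ := Submodule.mem_span_singleton.1 hm'
    rw [smul_comm, h, smul_zero]
  | sup N₁ N₂ _ _ h₁ h₂ =>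
    obtain ⟨u₁, hu₁, h₁⟩ := h₁ fun m hm => h m (Submodule.mem_sup_left hm)
    obtain ⟨u₂, hu₂, h₂⟩ := h₂ fun m hm => h m (Submodule.mem_sup_right hm)
    refine ⟨u₁ * u₂, S.mul_mem hu₁ hu₂, fun m hm => ?_⟩
    obtain ⟨m₁, hm₁, m₂, hm₂, rfl⟩ := Submodule.mem_sup.1 hm
    rw [smul_add, mul_comm, mul_smul, h₁ _ hm₁, smul_zero, zero_add, mul_comm, mul_smul,
      h₂ _ hm₂, smul_zero]

lemma exists_forall_mem_smul_smul_eq_zero {I : Ideal R} (hI : I.FG) {m : M}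
    (h : ∀ x ∈ I, ∃ u ∈ S, u • x • m = 0) : ∃ u ∈ S, ∀ x ∈ I, u • x • m = 0 := by
  simpa using exists_smul_eq_zero_of_fg S (Submodule.FG.map (LinearMap.toSpanSingleton R M m) hI)
    (by simpa)

lemma mem_torsionBySet_map_iff {A N : Type*} [CommRing A] [Algebra R A] [AddCommGroup N]
    [Module R N] [Module A N] [IsScalarTower R A N] {I : Ideal R} {z : N} :
    z ∈ Submodule.torsionBySet A N (I.map (algebraMap R A)) ↔ ∀ x ∈ I, x • z = 0 := by
  rw [Ideal.map, ← Submodule.torsionBySet_eq_torsionBySet_span]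
  simp [Submodule.mem_torsionBySet_iff]

lemma range_localizedModuleMap_subtype (N : Submodule R M) :
    LinearMap.range (LocalizedModule.map S N.subtype) = N.localized S := by
  ext z
  rw [Submodule.mem_localized']
  simp only [← IsLocalizedModule.mk_eq_mk']
  constructor
  · rintro ⟨w, rfl⟩
    induction w with | _ m s
    exact ⟨m, m.2, s, (LocalizedModule.map_mk S N.subtype m s).symm⟩
  · rintro ⟨m, hm, s, rfl⟩
    exact ⟨LocalizedModule.mk ⟨m, hm⟩ s, LocalizedModule.map_mk S N.subtype ⟨m, hm⟩ s⟩

variable (M)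

theorem torsionBySet_localized {I : Ideal R} (hI : I.FG) :
    Submodule.torsionBySet (Localization S) (LocalizedModule S M)
        (I.map (algebraMap R (Localization S))) =
      (Submodule.torsionBySet R M I).localized S := by
  ext z
  rw [mem_torsionBySet_map_iff, Submodule.mem_localized']
  simp only [← IsLocalizedModule.mk_eq_mk']
  constructor
  · induction z with | _ m s
    intro h
    obtain ⟨u, hu, h⟩ := exists_forall_mem_smul_smul_eq_zero S hI fun x hx =>
      (localizedModule_mk_eq_zero_iff S).1 ((LocalizedModule.smul'_mk x m s).symm.trans (h x hx))
    refine ⟨u • m, (Submodule.mem_torsionBySet_iff _ _).2 fun x => ?_, ⟨u, hu⟩ * s,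
      LocalizedModule.mk_cancel_common_left ⟨u, hu⟩ s m⟩
    rw [smul_comm, h x x.2]
  · rintro ⟨m, hm, s, rfl⟩ x hx
    rw [LocalizedModule.smul'_mk, (Submodule.mem_torsionBySet_iff _ _).1 hm ⟨x, hx⟩,
      LocalizedModule.zero_mk]

variable [IsNoetherianRing R] (a : Ideal R)

theorem primaryComponent_localized :
    (a.map (algebraMap R (Localization S))).primaryComponent (LocalizedModule S M) =
      (a.primaryComponent M).localized S := by
  simp only [Ideal.primaryComponent, Submodule.localized, Submodule.localized'_iSup]
  simp only [← Ideal.map_pow, torsionBySet_localized S M (IsNoetherian.noetherian _)]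

/-- `Γ_a` commutes with localization. -/
noncomputable def localizedPrimaryComponentEquiv :
    LocalizedModule S (a.primaryComponent M) ≃ₗ[Localization S]
      (a.map (algebraMap R (Localization S))).primaryComponent (LocalizedModule S M) :=
  (LinearEquiv.ofInjective _ (LocalizedModule.map_injective S _
    (Submodule.subtype_injective _))).trans (LinearEquiv.ofEq _ _
      ((range_localizedModuleMap_subtype S _).trans (primaryComponent_localized S M a).symm))

variable {M} in
lemma localizedPrimaryComponentEquiv_mk (m : a.primaryComponent M) (s : S) :
    (localizedPrimaryComponentEquiv S M a (LocalizedModule.mk m s) : LocalizedModule S M) =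
      LocalizedModule.mk m.1 s :=
  LocalizedModule.map_mk S (a.primaryComponent M).subtype m s

variable {M} in
lemma localizedPrimaryComponentEquiv_naturality {N : Type*} [AddCommGroup N] [Module R N]
    (g : M →ₗ[R] N) (z : LocalizedModule S (a.primaryComponent M)) :
    localizedPrimaryComponentEquiv S N a
        (LocalizedModule.map S (Ideal.primaryComponent.map a g) z) =
      Ideal.primaryComponent.map (a.map (algebraMap R (Localization S))) (LocalizedModule.map S g)
        (localizedPrimaryComponentEquiv S M a z) := by
  induction z with | _ m s
  refine Subtype.ext ?_
  change _ = LocalizedModule.map S g (localizedPrimaryComponentEquiv S M a _).1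
  rw [LocalizedModule.map_mk, localizedPrimaryComponentEquiv_mk,
    localizedPrimaryComponentEquiv_mk, LocalizedModule.map_mk]
  rfl

end Localization

section LocalCohomology

lemma nonempty_equiv_of_exact {A X Y Z X' Y' Z' : Type*} [CommRing A] [AddCommGroup X] [Module A X]
    [AddCommGroup Y] [Module A Y] [AddCommGroup Z] [Module A Z] [AddCommGroup X'] [Module A X']
    [AddCommGroup Y'] [Module A Y'] [AddCommGroup Z'] [Module A Z'] {f : X →ₗ[A] Y} {g : Y →ₗ[A] Z}
    {f' : X' →ₗ[A] Y'} {g' : Y' →ₗ[A] Z'} (hfg : Function.Exact f g) (hg : Function.Surjective g)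
    (hfg' : Function.Exact f' g') (hg' : Function.Surjective g') (e : X ≃ₗ[A] X')
    (e' : Y ≃ₗ[A] Y') (comm : ∀ x, e' (f x) = f' (e x)) : Nonempty (Z ≃ₗ[A] Z') := by
  have map_range : (LinearMap.range f).map e'.toLinearMap = LinearMap.range f' := by
    rw [← LinearMap.range_comp, ← LinearEquiv.range_comp e f']
    exact congrArg LinearMap.range (LinearMap.ext comm)
  exact ⟨(hfg.linearEquivOfSurjective hg).symm.trans
    ((Submodule.Quotient.equiv _ _ e' map_range).trans (hfg'.linearEquivOfSurjective hg'))⟩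

variable {R : Type u} [CommRing R] [IsNoetherianRing R] (S : Submonoid R)

theorem nonempty_localized_localCohomology_equiv (a : Ideal R) (i : ℕ) (M : Type u)
    [AddCommGroup M] [Module R M] :
    Nonempty (LocalizedModule S (H a i M) ≃ₗ[Localization S]
      H (a.map (algebraMap R (Localization S))) i (LocalizedModule S M)) := by
  have localizedCongr {X Y : Type u} [AddCommGroup X] [Module R X] [AddCommGroup Y] [Module R Y]
      (e : X ≃ₗ[R] Y) : LocalizedModule S X ≃ₗ[Localization S] LocalizedModule S Y :=
    IsLocalizedModule.mapEquiv S (LocalizedModule.mkLinearMap S X)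
      (LocalizedModule.mkLinearMap S Y) (Localization S) e
  induction i using Nat.strong_induction_on generalizing M with | _ i ih
  rcases i with _ | i
  · exact ⟨(localizedCongr (localCohomologyZeroEquiv a M)).trans
      ((localizedPrimaryComponentEquiv S M a).trans (localCohomologyZeroEquiv _ _).symm)⟩
  obtain ⟨E, C, f, g, _, hf, hfg, hg⟩ := exists_shortExact_injective R M
  have hfS := LocalizedModule.map_injective S f hf
  have hgS := LocalizedModule.map_surjective S g hg
  have hfgS : Function.Exact (LocalizedModule.map S f) (LocalizedModule.map S g) :=
    LocalizedModule.map_exact S f g hfg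
  have : Module.Injective (Localization S) (LocalizedModule S E) :=
    Module.injective_of_isLocalizedModule S (LocalizedModule.mkLinearMap S E)
  rcases i with _ | i
  · obtain ⟨φ, hφ, hφ'⟩ := exists_exact_primaryComponent_map a hf hfg hg
    obtain ⟨ψ, hψ, hψ'⟩ := exists_exact_primaryComponent_map
      (a.map (algebraMap R (Localization S))) hfS hfgS hgS
    exact nonempty_equiv_of_exact
      (f' := Ideal.primaryComponent.map _ (LocalizedModule.map S g))
      (LocalizedModule.map_exact S _ φ hφ) (LocalizedModule.map_surjective S φ hφ') hψ hψ'
      (localizedPrimaryComponentEquiv S E a) (localizedPrimaryComponentEquiv S C a)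
      (localizedPrimaryComponentEquiv_naturality S a g)
  · obtain ⟨e₁⟩ := nonempty_localCohomology_succ_equiv a hf hfg hg i
    obtain ⟨e₂⟩ := nonempty_localCohomology_succ_equiv (a.map (algebraMap R (Localization S)))
      hfS hfgS hgS i
    obtain ⟨e₃⟩ := ih (i + 1) (by lia) C
    exact ⟨((localizedCongr e₁).trans e₃).trans e₂.symm⟩

end LocalCohomology

/-- The `R`-module `Ext^k(X, L)`, bundled so that Serre classes of `R`-modules apply to it. -/
noncomputable abbrev extModule {R : Type u} [CommRing R] (X : ModuleCat.{u} R) (k : ℕ) (L : Type u)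
    [AddCommGroup L] [Module R L] : ModuleCat.{u} R :=
  ModuleCat.of R (Ext X (ModuleCat.of R L) k)

/-- The `R`-module `Ext^k(R ⧸ a, L)`. -/
noncomputable abbrev extQuot {R : Type u} [CommRing R] (a : Ideal R) (k : ℕ) (L : Type u)
    [AddCommGroup L] [Module R L] : ModuleCat.{u} R :=
  extModule (ModuleCat.of R (R ⧸ a)) k L

section SerreClass

variable {R : Type u} [CommRing R] (P : ObjectProperty (ModuleCat.{u} R)) [P.IsSerreClass]

lemma prop_of_injective {A B : ModuleCat.{u} R} (f : A →ₗ[R] B) (hf : Function.Injective f)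
    (h : P B) : P A :=
  have : Mono (ModuleCat.ofHom f) := (ModuleCat.mono_iff_injective _).2 hf
  P.prop_of_mono (ModuleCat.ofHom f) h

lemma prop_of_surjective {A B : ModuleCat.{u} R} (f : A →ₗ[R] B) (hf : Function.Surjective f)
    (h : P A) : P B :=
  have : Epi (ModuleCat.ofHom f) := (ModuleCat.epi_iff_surjective _).2 hf
  P.prop_of_epi (ModuleCat.ofHom f) h

lemma prop_of_subsingleton (A : ModuleCat.{u} R) [Subsingleton A] : P A :=
  P.prop_of_isZero (ModuleCat.isZero_of_subsingleton A)

lemma prop_range_of_ker_le_ker {A B C : ModuleCat.{u} R} {f : A →ₗ[R] B} {g : A →ₗ[R] C}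
    (h : LinearMap.ker g ≤ LinearMap.ker f) (hC : P C) :
    P (ModuleCat.of R (LinearMap.range f)) := by
  refine prop_of_surjective P (A := ModuleCat.of R (A ⧸ LinearMap.ker g))
    ((LinearMap.ker g).liftQ f.rangeRestrict (by rwa [LinearMap.ker_rangeRestrict])) ?_
    (prop_of_injective P (A := ModuleCat.of R (A ⧸ LinearMap.ker g))
      ((LinearMap.ker g).liftQ g le_rfl)
      (LinearMap.ker_eq_bot.1 (Submodule.ker_liftQ_eq_bot _ _ _ le_rfl)) hC)
  rintro ⟨_, x, rfl⟩
  exact ⟨Submodule.Quotient.mk x, rfl⟩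

lemma prop_of_ker_le_range {A B C : ModuleCat.{u} R} {f : A →ₗ[R] B} {g : B →ₗ[R] C}
    (h : LinearMap.ker g ≤ LinearMap.range f) (hA : P A) (hC : P C) : P B := by
  have prop_ker : P (ModuleCat.of R (LinearMap.ker g)) :=
    prop_of_injective P (B := ModuleCat.of R (LinearMap.range f)) (Submodule.inclusion h)
      (Submodule.inclusion_injective h) (prop_of_surjective P f.rangeRestrict
        f.surjective_rangeRestrict hA)
  exact P.prop_X₂_of_exact (S := LinearMap.shortComplexKer g)
    ((ShortComplex.ShortExact.moduleCat_exact_iff_function_exact _).2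
      (LinearMap.exact_subtype_ker_map g)) prop_ker hC

instance isSerreClass_isFG [IsNoetherianRing R] : (ModuleCat.isFG.{u} R).IsSerreClass where
  exists_zero := ⟨ModuleCat.of R PUnit, ModuleCat.isZero_of_subsingleton _,
    inferInstanceAs (Module.Finite R PUnit.{u + 1})⟩
  prop_of_mono f _ (_ : Module.Finite R _) :=
    Module.Finite.of_injective f.hom ((ModuleCat.mono_iff_injective f).1 inferInstance)
  prop_of_epi f _ (_ : Module.Finite R _) :=
    Module.Finite.of_surjective f.hom ((ModuleCat.epi_iff_surjective f).1 inferInstance)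
  prop_X₂_of_shortExact {S} hS (_ : Module.Finite R _) (_ : Module.Finite R _) :=
    Module.Finite.of_exact ((ShortComplex.ShortExact.moduleCat_exact_iff_function_exact S).1
      hS.exact) hS.moduleCat_surjective_g

section Ext

variable {P} {X : ModuleCat.{u} R} {A B C : Type u} [AddCommGroup A] [Module R A] [AddCommGroup B]
  [Module R B] [AddCommGroup C] [Module R C] {f : A →ₗ[R] B} {g : B →ₗ[R] C}

lemma prop_ext_of_equiv (e : A ≃ₗ[R] B) (k : ℕ) (h : P (extModule X k A)) :
    P (extModule X k B) := by
  refine prop_of_surjective P ((Ext.mk₀ (ModuleCat.ofHom e.toLinearMap)).postcompOfLinear R X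
    (add_zero k)) (fun x => ⟨x.comp (Ext.mk₀ (ModuleCat.ofHom e.symm.toLinearMap)) (add_zero k),
      ?_⟩) h
  have : ModuleCat.ofHom e.symm.toLinearMap ≫ ModuleCat.ofHom e.toLinearMap =
      𝟙 (ModuleCat.of R B) := by ext; simp
  simp [this]

lemma prop_ext_zero_of_injective (hf : Function.Injective f) (hB : P (extModule X 0 B)) :
    P (extModule X 0 A) := by
  have : Mono (ModuleCat.ofHom f) := (ModuleCat.mono_iff_injective _).2 hf
  exact prop_of_injective P ((Ext.mk₀ (ModuleCat.ofHom f)).postcompOfLinear R X (add_zero 0))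
    (Ext.postcomp_mk₀_injective_of_mono _ _) hB

lemma prop_ext_succ_of_moduleInjective [Module.Injective R A] (k : ℕ) :
    P (extModule X (k + 1) A) := by
  have : Injective (ModuleCat.of R A) := Module.injective_object_of_injective_module R A
  have : Subsingleton (extModule X (k + 1) A) := Ext.subsingleton_of_injective _ _ _
  exact prop_of_subsingleton P _

lemma prop_ext_of_subsingleton [Subsingleton A] (k : ℕ) : P (extModule X k A) := by
  have : Subsingleton (extModule X k A) := subsingleton_of_forall_eq 0 fun x => by
    have id_eq_zero := (ModuleCat.isZero_of_subsingleton (ModuleCat.of R A)).eq_of_src (𝟙 _) 0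
    rw [← Ext.comp_mk₀_id x, id_eq_zero, Ext.mk₀_zero, Ext.comp_zero]
  exact prop_of_subsingleton P _

section ShortExact

variable (hf : Function.Injective f) (hfg : Function.Exact f g) (hg : Function.Surjective g) (k : ℕ)
include hf hfg hg

lemma prop_ext_middle (hA : P (extModule X k A)) (hC : P (extModule X k C)) :
    P (extModule X k B) := by
  have hS := ModuleCat.shortComplex_shortExact
    (ShortComplex.moduleCatMk f g hfg.linearMap_comp_eq_zero) hfg hf hg
  refine prop_of_ker_le_range P
    (f := (Ext.mk₀ (ModuleCat.ofHom f)).postcompOfLinear R X (add_zero k))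
    (g := (Ext.mk₀ (ModuleCat.ofHom g)).postcompOfLinear R X (add_zero k))
    (fun x hx => ?_) hA hC
  exact Ext.covariant_sequence_exact₂ _ hS x hx

lemma prop_ext_right (hB : P (extModule X k B)) (hA : P (extModule X (k + 1) A)) :
    P (extModule X k C) := by
  have hS := ModuleCat.shortComplex_shortExact
    (ShortComplex.moduleCatMk f g hfg.linearMap_comp_eq_zero) hfg hf hg
  refine prop_of_ker_le_range P
    (f := (Ext.mk₀ (ModuleCat.ofHom g)).postcompOfLinear R X (add_zero k))
    (g := hS.extClass.postcompOfLinear R X rfl)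
    (fun x hx => ?_) hB hA
  exact Ext.covariant_sequence_exact₃ _ hS x rfl hx

lemma prop_ext_left (hC : P (extModule X k C)) (hB : P (extModule X (k + 1) B)) :
    P (extModule X (k + 1) A) := by
  have hS := ModuleCat.shortComplex_shortExact
    (ShortComplex.moduleCatMk f g hfg.linearMap_comp_eq_zero) hfg hf hg
  refine prop_of_ker_le_range P
    (f := hS.extClass.postcompOfLinear R X rfl)
    (g := (Ext.mk₀ (ModuleCat.ofHom f)).postcompOfLinear R X (add_zero (k + 1)))
    (fun x hx => ?_) hC hB
  exact Ext.covariant_sequence_exact₁ _ hS x hx rfl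

end ShortExact

end Ext

end SerreClass

section PrimaryComponent

lemma exact_primaryComponent_map {R M E C : Type*} [CommRing R] [AddCommGroup M] [Module R M]
    [AddCommGroup E] [Module R E] [AddCommGroup C] [Module R C] (a : Ideal R) {f : M →ₗ[R] E}
    {g : E →ₗ[R] C} (hf : Function.Injective f) (hfg : Function.Exact f g) :
    Function.Exact (Ideal.primaryComponent.map a f) (Ideal.primaryComponent.map a g) := by
  intro e
  rw [← Subtype.coe_inj]
  constructor
  · intro he
    obtain ⟨m, hm⟩ := (hfg e).1 he
    obtain ⟨t, ht⟩ := mem_primaryComponent_iff.1 e.2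
    exact ⟨⟨m, mem_primaryComponent_iff.2 ⟨t, fun x hx => hf (by rw [map_smul, hm, ht x hx,
      map_zero])⟩⟩, Subtype.ext hm⟩
  · rintro ⟨m, rfl⟩
    exact hfg.apply_apply_eq_zero m.1

lemma torsionBySet_quotient_primaryComponent {R : Type*} [CommRing R] {a : Ideal R} (ha : a.FG)
    (M : Type*) [AddCommGroup M] [Module R M] :
    Submodule.torsionBySet R (M ⧸ a.primaryComponent M) a = ⊥ := by
  refine (Submodule.eq_bot_iff _).2 fun z hz => ?_
  obtain ⟨m, rfl⟩ := Submodule.Quotient.mk_surjective _ z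
  have smul_span_le : a • Submodule.span R {m} ≤ a.primaryComponent M := by
    refine Submodule.smul_le.2 fun x hx n hn => ?_
    obtain ⟨r, rfl⟩ := Submodule.mem_span_singleton.1 hn
    rw [smul_comm]
    exact Submodule.smul_mem _ _ ((Submodule.Quotient.mk_eq_zero _).1
      ((Submodule.mem_torsionBySet_iff _ _).1 hz ⟨x, hx⟩))
  obtain ⟨t, ht⟩ := exists_pow_smul_eq_zero_of_fg
    (Submodule.FG.smul ha (Submodule.fg_span_singleton m)) smul_span_le
  have pow_succ_smul : a ^ (t + 1) • Submodule.span R {m} ≤ ⊥ := by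
    rw [pow_succ, Submodule.mul_smul]
    exact Submodule.smul_le.2 ht
  exact (Submodule.Quotient.mk_eq_zero _).2 (mem_primaryComponent_iff.2 ⟨t + 1, fun x hx =>
    pow_succ_smul (Submodule.smul_mem_smul hx (Submodule.mem_span_singleton_self m))⟩)

end PrimaryComponent

-- `Hom(R ⧸ a, Γ_a(C)) = Hom(R ⧸ a, C)`, and a map `R ⧸ a → C` which lifts to `E` lifts to `Γ_a(E)`.
lemma ker_le_ker_postcomp {R : Type u} [CommRing R] {a : Ideal R} {M E C L : Type u}
    [AddCommGroup M] [Module R M] [AddCommGroup E] [Module R E] [AddCommGroup C] [Module R C]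
    [AddCommGroup L] [Module R L] {f : M →ₗ[R] E} {g : E →ₗ[R] C}
    {φ : a.primaryComponent C →ₗ[R] L} (hf : Function.Injective f) (hfg : Function.Exact f g)
    (hg : Function.Surjective g) (hgφ : Function.Exact (Ideal.primaryComponent.map a g) φ)
    (x : extQuot a 0 (a.primaryComponent C))
    (hx : ((x.comp (Ext.mk₀ (ModuleCat.ofHom (a.primaryComponent C).subtype)) (add_zero 0)).comp
      (ModuleCat.shortComplex_shortExact
        (ShortComplex.moduleCatMk f g hfg.linearMap_comp_eq_zero) hfg hf hg).extClass
          (zero_add 1)) = 0) :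
    x.comp (Ext.mk₀ (ModuleCat.ofHom φ)) (add_zero 0) = 0 := by
  obtain ⟨y, hy⟩ := Ext.covariant_sequence_exact₃ _ _ _ (zero_add 1) hx
  obtain ⟨ξ, rfl⟩ := (Ext.mk₀_bijective _ _).2 x
  obtain ⟨η, rfl⟩ := (Ext.mk₀_bijective _ _).2 y
  rw [Ext.mk₀_comp_mk₀, Ext.mk₀_comp_mk₀] at hy
  have lift := (Ext.mk₀_bijective _ _).1 hy
  have comp_eq_zero : ξ ≫ ModuleCat.ofHom φ = 0 := by
    ext
    refine (hgφ _).2 ⟨⟨η _, mem_primaryComponent_iff.2 ⟨1, fun x hx => ?_⟩⟩,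
      Subtype.ext congr($lift _)⟩
    rw [pow_one] at hx
    exact (map_smul η.hom x _).symm.trans ((congrArg η.hom
      (Module.mem_annihilator.1 (Ideal.annihilator_quotient.ge hx) _)).trans (map_zero η.hom))
  rw [Ext.mk₀_comp_mk₀, comp_eq_zero, Ext.mk₀_zero]

section LocalCohomology

variable {R : Type u} [CommRing R] [IsNoetherianRing R] {P : ObjectProperty (ModuleCat.{u} R)}
  [P.IsSerreClass] {a : Ideal R}

lemma prop_ext_one_primaryComponent {C : Type u} [AddCommGroup C] [Module R C]
    (h : P (extQuot a 1 C)) : P (extQuot a 1 (a.primaryComponent C)) := by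
  have : Subsingleton (Submodule.torsionBySet R (C ⧸ a.primaryComponent C) a) :=
    Submodule.subsingleton_iff_eq_bot.2
      (torsionBySet_quotient_primaryComponent (IsNoetherian.noetherian a) C)
  have : Subsingleton (extQuot a 0 (C ⧸ a.primaryComponent C)) :=
    (extZeroEquiv a _).toEquiv.subsingleton
  exact prop_ext_left (Submodule.subtype_injective _) (LinearMap.exact_subtype_mkQ _)
    (Submodule.mkQ_surjective (a.primaryComponent C)) 0 (prop_of_subsingleton P _) h

section Sequence

variable {M E C L : Type u} [AddCommGroup M] [Module R M] [AddCommGroup E] [Module R E]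
  [AddCommGroup C] [Module R C] [AddCommGroup L] [Module R L] [Module.Injective R E]
  {f : M →ₗ[R] E} {g : E →ₗ[R] C} {φ : a.primaryComponent C →ₗ[R] L}
  (hf : Function.Injective f) (hfg : Function.Exact f g) (hg : Function.Surjective g)
  (hgφ : Function.Exact (Ideal.primaryComponent.map a g) φ) (hφ : Function.Surjective φ)
include hf hfg hgφ

lemma prop_ext_ker (k : ℕ) (hM : P (extQuot a (k + 2) (a.primaryComponent M))) :
    P (extQuot a (k + 1) (LinearMap.ker φ)) := by
  let γ : a.primaryComponent E →ₗ[R] LinearMap.ker φ :=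
    (Ideal.primaryComponent.map a g).codRestrict _ fun e => hgφ.apply_apply_eq_zero e
  have hγ : Function.Surjective γ := fun z => by
    obtain ⟨e, he⟩ := (hgφ z).1 z.2
    exact ⟨e, Subtype.ext he⟩
  have hfγ : Function.Exact (Ideal.primaryComponent.map a f) γ := fun e =>
    Subtype.ext_iff.trans (exact_primaryComponent_map a hf hfg e)
  have injective_map : Function.Injective (Ideal.primaryComponent.map a f) := fun x y h =>
    Subtype.ext (hf (congrArg Subtype.val h))
  have := injective_primaryComponent a E
  exact prop_ext_right injective_map hfγ hγ (k + 1) (prop_ext_succ_of_moduleInjective k) hM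

section Surjective

include hφ

lemma prop_ext_primaryComponent (k : ℕ) (hM : P (extQuot a (k + 2) (a.primaryComponent M)))
    (hL : P (extQuot a (k + 1) L)) : P (extQuot a (k + 1) (a.primaryComponent C)) :=
  prop_ext_middle (Submodule.subtype_injective _) (LinearMap.exact_subtype_ker_map φ) hφ (k + 1)
    (prop_ext_ker hf hfg hgφ k hM) hL

include hg

lemma prop_ext_one_cokernel (hM : P (extQuot a 3 (a.primaryComponent M)))
    (h : P (extQuot a 2 M)) : P (extQuot a 1 L) :=
  prop_ext_right (Submodule.subtype_injective _) (LinearMap.exact_subtype_ker_map φ) hφ 1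
    (prop_ext_one_primaryComponent
      (prop_ext_right hf hfg hg 1 (prop_ext_succ_of_moduleInjective 0) h))
    (prop_ext_ker hf hfg hgφ 1 hM)

end Surjective

include hg hφ

lemma prop_ext_zero_cokernel (hM : P (extQuot a 2 (a.primaryComponent M)))
    (h : P (extQuot a 1 M)) : P (extQuot a 0 L) := by
  have hS := ModuleCat.shortComplex_shortExact
    (ShortComplex.moduleCatMk f g hfg.linearMap_comp_eq_zero) hfg hf hg
  have hS' := LinearMap.shortExact_shortComplexKer hφ
  let X := ModuleCat.of R (R ⧸ a)
  let θ : extQuot a 0 (a.primaryComponent C) →ₗ[R] extQuot a 0 L :=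
    (Ext.mk₀ (ModuleCat.ofHom φ)).postcompOfLinear R X (add_zero 0)
  let δ : extQuot a 0 (a.primaryComponent C) →ₗ[R] extQuot a 1 M :=
    (hS.extClass.postcompOfLinear R X (zero_add 1)).comp
      ((Ext.mk₀ (ModuleCat.ofHom (a.primaryComponent C).subtype)).postcompOfLinear R X (add_zero 0))
  have prop_range : P (ModuleCat.of R (LinearMap.range θ)) :=
    prop_range_of_ker_le_ker P (g := δ) (ker_le_ker_postcomp hf hfg hg hgφ) h
  refine prop_of_ker_le_range P (f := (LinearMap.range θ).subtype)
    (g := hS'.extClass.postcompOfLinear R X (zero_add 1)) (fun x hx => ?_) prop_range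
    (prop_ext_ker hf hfg hgφ 0 hM)
  rw [Submodule.range_subtype]
  exact Ext.covariant_sequence_exact₃ _ hS' x (zero_add 1) hx

end Sequence

theorem prop_ext_localCohomology_succ (i : ℕ) (M : Type u) [AddCommGroup M] [Module R M]
    (h₀ : ∀ k, P (extQuot a (k + 2) (a.primaryComponent M)))
    (hH : ∀ j < i, ∀ k, P (extQuot a k (H a (j + 1) M))) :
    (P (extQuot a (i + 1) M) → P (extQuot a 0 (H a (i + 1) M))) ∧
      (P (extQuot a (i + 2) M) → P (extQuot a 1 (H a (i + 1) M))) := by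
  induction i generalizing M with
  | zero =>
    obtain ⟨E, C, f, g, _, hf, hfg, hg⟩ := exists_shortExact_injective R M
    obtain ⟨φ, hgφ, hφ⟩ := exists_exact_primaryComponent_map a hf hfg hg
    exact ⟨prop_ext_zero_cokernel hf hfg hg hgφ hφ (h₀ 0),
      prop_ext_one_cokernel hf hfg hg hgφ hφ (h₀ 1)⟩
  | succ i ih =>
    obtain ⟨E, C, f, g, _, hf, hfg, hg⟩ := exists_shortExact_injective R M
    obtain ⟨φ, hgφ, hφ⟩ := exists_exact_primaryComponent_map a hf hfg hg
    obtain ⟨ih_zero, ih_one⟩ := ih C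
      (fun k => prop_ext_primaryComponent hf hfg hgφ hφ (k + 1) (h₀ (k + 1))
        (hH 0 (Nat.succ_pos i) _))
      (fun j hj k => by
        obtain ⟨e⟩ := nonempty_localCohomology_succ_equiv a hf hfg hg j
        exact prop_ext_of_equiv e k (hH (j + 1) (Nat.succ_lt_succ hj) k))
    obtain ⟨e⟩ := nonempty_localCohomology_succ_equiv a hf hfg hg i
    exact ⟨fun h => prop_ext_of_equiv e.symm 0
        (ih_zero (prop_ext_right hf hfg hg _ (prop_ext_succ_of_moduleInjective i) h)),
      fun h => prop_ext_of_equiv e.symm 1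
        (ih_one (prop_ext_right hf hfg hg _ (prop_ext_succ_of_moduleInjective (i + 1)) h))⟩

end LocalCohomology

section Artinian

lemma exists_forall_ge_eq_of_antitone {α : Type*} [PartialOrder α] [WellFoundedLT α]
    {f : ℕ → ℕ → α} (hf : ∀ m, Antitone (f · m)) (hf' : ∀ k, Antitone (f k)) :
    ∃ n, ∀ m, n ≤ m → ∀ k, f k m = f k n := by
  have antitone_diag : Antitone fun n => f n n := fun i j h => (hf j h).trans (hf' i h)
  obtain ⟨n₀, diag_eq⟩ := WellFoundedLT.antitone_chain_condition antitone_diag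
  choose s row_eq using fun k => WellFoundedLT.antitone_chain_condition (hf' k)
  let n := n₀ + (Finset.range n₀).sup s
  refine ⟨n, fun m hm k => ?_⟩
  obtain hk | hk := lt_or_ge k n₀
  · have hsn : s k ≤ n :=
      (Finset.le_sup (Finset.mem_range.2 hk)).trans (Nat.le_add_left _ _)
    exact (row_eq k m (hsn.trans hm)).symm.trans (row_eq k n hsn)
  · refine le_antisymm (hf' k hm) ?_
    calc f k n ≤ f n₀ n₀ := (hf n hk).trans (hf' n₀ (Nat.le_add_right _ _))
      _ = f (max k m) (max k m) := diag_eq _ (hk.trans (le_max_left _ _))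
      _ ≤ f k m := (hf _ (le_max_left _ _)).trans (hf' k (le_max_right _ _))

variable {R : Type*} [CommRing R] {L : Type*} [AddCommGroup L] [Module R L]

/-- The submodule `x ^ k N ∩ (0 :_L x)`, regarded inside `(0 :_L x)`. For varying `k` these
submodules determine `N` among its submodules when every element of `L` is killed by a power of
`x`. -/
def powTorsion (x : R) (k : ℕ) (N : Submodule R L) : Submodule R (Submodule.torsionBy R L x) :=
  (N.map (LinearMap.lsmul R L (x ^ k))).comap (Submodule.torsionBy R L x).subtype

lemma mem_powTorsion {x : R} {k : ℕ} {N : Submodule R L} {z : Submodule.torsionBy R L x} :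
    z ∈ powTorsion x k N ↔ ∃ n ∈ N, x ^ k • n = z := by
  simp [powTorsion, Submodule.mem_map]

lemma powTorsion_mono (x : R) (k : ℕ) : Monotone (powTorsion (L := L) x k) := fun _ _ h =>
  Submodule.comap_mono (Submodule.map_mono h)

lemma powTorsion_antitone (x : R) (N : Submodule R L) : Antitone (powTorsion x · N) := by
  intro k k' hk z hz
  obtain ⟨n, hn, h⟩ := mem_powTorsion.1 hz
  refine mem_powTorsion.2 ⟨x ^ (k' - k) • n, N.smul_mem _ hn, ?_⟩
  rw [smul_smul, ← pow_add, Nat.add_sub_cancel' hk, h]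

lemma le_of_powTorsion_le {x : R} (hx : ∀ z : L, ∃ k : ℕ, x ^ k • z = 0) {N N' : Submodule R L}
    (hN : N ≤ N') (h : ∀ k, powTorsion x k N' ≤ powTorsion x k N) : N' ≤ N := by
  suffices mem_of_pow_smul : ∀ k : ℕ, ∀ z ∈ N', x ^ k • z = 0 → z ∈ N from fun z hz =>
    (hx z).elim fun k => mem_of_pow_smul k z hz
  intro k
  induction k with
  | zero =>
    intro z _ hz
    rw [pow_zero, one_smul] at hz
    exact hz ▸ N.zero_mem
  | succ k ih =>
    intro z hz hxz
    have mem_torsionBy : x ^ k • z ∈ Submodule.torsionBy R L x := by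
      rw [Submodule.mem_torsionBy_iff, smul_smul, ← pow_succ', hxz]
    obtain ⟨n, hn, hnz⟩ := mem_powTorsion.1
      (h k (mem_powTorsion.2 ⟨z, hz, rfl⟩ : ⟨_, mem_torsionBy⟩ ∈ powTorsion x k N'))
    have sub_mem : z - n ∈ N :=
      ih (z - n) (N'.sub_mem hz (hN hn)) (by rw [smul_sub, hnz, sub_self])
    exact (N.sub_mem_iff_left hn).1 sub_mem

lemma isArtinian_of_torsionBy {x : R} (hx : ∀ z : L, ∃ k : ℕ, x ^ k • z = 0)
    [IsArtinian R (Submodule.torsionBy R L x)] : IsArtinian R L := by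
  refine monotone_stabilizes_iff_artinian.1 fun N => ?_
  obtain ⟨n, hn⟩ := exists_forall_ge_eq_of_antitone
    (f := fun k m => powTorsion x k (OrderDual.ofDual (N m)))
    (fun m => powTorsion_antitone x _) (fun k _ _ h => powTorsion_mono x k (N.monotone h))
  exact ⟨n, fun m hm => le_antisymm (N.monotone hm)
    (le_of_powTorsion_le hx (N.monotone hm) fun k => (hn m hm k).ge)⟩

lemma IsPowTorsion.mono {a b : Ideal R} (hab : a ≤ b) (h : IsPowTorsion b L) :
    IsPowTorsion a L := fun z =>
  (h z).imp fun t ht x hx => ht x (Ideal.pow_right_mono hab t hx)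

lemma IsPowTorsion.of_injective {a : Ideal R} {M : Type*} [AddCommGroup M] [Module R M]
    (h : IsPowTorsion a L) (f : M →ₗ[R] L) (hf : Function.Injective f) : IsPowTorsion a M :=
  fun z => (h (f z)).imp fun t ht x hx => hf (by rw [map_smul, ht x hx, map_zero])

theorem isArtinian_of_torsionBySet {a : Ideal R} (ha : a.FG) (h : IsPowTorsion a L)
    [IsArtinian R (Submodule.torsionBySet R L a)] : IsArtinian R L := by
  induction a, ha using Submodule.fg_induction generalizing L with
  | singleton x =>
    rw [Submodule.torsionBySet_span_singleton_eq] at *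
    exact isArtinian_of_torsionBy fun z => (h z).imp fun t ht =>
      ht _ (Ideal.pow_mem_pow (Submodule.mem_span_singleton_self x) t)
  | sup b c _ _ ihb ihc =>
    let T := Submodule.torsionBySet R L b
    let ι : Submodule.torsionBySet R T c →ₗ[R] L := T.subtype ∘ₗ Submodule.subtype _
    have mem_torsionBySet_sup (z : Submodule.torsionBySet R T c) :
        ι z ∈ Submodule.torsionBySet R L (b ⊔ c : Ideal R) := by
      refine (Submodule.mem_torsionBySet_iff _ _).2 fun ⟨x, hx⟩ => ?_
      obtain ⟨y, hy, w, hw, rfl⟩ := Submodule.mem_sup.1 hx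
      have hyz : y • ι z = 0 := (Submodule.mem_torsionBySet_iff _ _).1 z.1.2 ⟨y, hy⟩
      have hwz : w • z.1 = 0 := (Submodule.mem_torsionBySet_iff _ _).1 z.2 ⟨w, hw⟩
      exact (add_smul y w (ι z)).trans (by rw [hyz, zero_add]; exact congrArg Subtype.val hwz)
    have : IsArtinian R (Submodule.torsionBySet R T c) :=
      isArtinian_of_injective (ι.codRestrict _ mem_torsionBySet_sup)
        ((LinearMap.injective_codRestrict_iff _).2
          (T.subtype_injective.comp (Submodule.subtype_injective _)))
    have : IsArtinian R T :=
      ihc ((h.mono le_sup_right).of_injective T.subtype T.subtype_injective)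
    exact ihb (h.mono le_sup_left)

lemma isArtinian_of_support [IsNoetherianRing R] [Module.Finite R L]
    (h : ∀ p ∈ Module.support R L, p.asIdeal.IsMaximal) : IsArtinian R L := by
  induction ‹Module.Finite R L› using
    IsNoetherianRing.induction_on_isQuotientEquivQuotientPrime R with
  | subsingleton N => infer_instance
  | quotient N p e =>
    have : p.asIdeal.IsMaximal := h p (by
      rw [e.support_eq, Module.support_eq_zeroLocus, Ideal.annihilator_quotient]
      exact (PrimeSpectrum.mem_zeroLocus p _).2 le_rfl)
    have : IsSimpleModule R (R ⧸ p.asIdeal) := isSimpleModule_iff_isCoatom.2 this.out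
    exact isArtinian_of_linearEquiv e.symm
  | exact A B C f g hf hg hfg ihA ihC =>
    rw [Module.support_of_exact hfg hf hg] at h
    have := ihA fun p hp => h p (Or.inl hp)
    have := ihC fun p hp => h p (Or.inr hp)
    exact isArtinian_of_range_eq_ker f g hfg.linearMap_ker_eq.symm

end Artinian

section Secondary

variable {R : Type*} [CommRing R] {L : Type*} [AddCommGroup L] [Module R L] [IsArtinian R L]
  {N : Submodule R L}

-- Fitting's lemma: the kernel and the image of a large power of `x` span `N`.
lemma surjective_lsmul_or_mem_radical_annihilator (hN : SupIrred N) (x : R) :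
    Function.Surjective (LinearMap.lsmul R N x) ∨ x ∈ N.annihilator.radical := by
  obtain ⟨k, codisjoint, hk⟩ := ((LinearMap.eventually_codisjoint_ker_pow_range_pow
    (LinearMap.lsmul R N x)).and (Filter.eventually_ne_atTop 0)).exists
  have eq_top {K : Submodule R N} (hK : K.map N.subtype = N) : K = ⊤ :=
    Submodule.map_injective_of_injective N.subtype_injective
      (hK.trans (Submodule.map_subtype_top N).symm)
  have pow_apply (z : N) : (LinearMap.lsmul R N x ^ k) z = x ^ k • z := by
    rw [Module.End.pow_apply]
    exact smul_iterate_apply x k z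
  have sup_eq : (LinearMap.ker (LinearMap.lsmul R N x ^ k)).map N.subtype ⊔
      (LinearMap.range (LinearMap.lsmul R N x ^ k)).map N.subtype = N := by
    rw [← Submodule.map_sup, codisjoint.eq_top, Submodule.map_subtype_top]
  refine (hN.2 sup_eq).symm.imp (fun h => ?_)
    (fun h => ⟨k, Submodule.mem_annihilator.2 fun z hz => ?_⟩)
  · obtain ⟨j, rfl⟩ := Nat.exists_eq_succ_of_ne_zero hk
    have surjective_pow := LinearMap.range_eq_top.1 (eq_top h)
    rw [pow_succ'] at surjective_pow
    exact Function.Surjective.of_comp surjective_pow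
  · have pow_smul_eq_zero : x ^ k • (⟨z, hz⟩ : N) = 0 :=
      (pow_apply _).symm.trans (LinearMap.mem_ker.1 ((eq_top h).ge trivial))
    exact congrArg Subtype.val pow_smul_eq_zero

lemma isPrime_radical_annihilator (hN : SupIrred N) : N.annihilator.radical.IsPrime where
  ne_top' h := hN.ne_bot (Submodule.annihilator_eq_top_iff.1 (Ideal.radical_eq_top.1 h))
  mem_or_mem' {x y} := by
    rintro ⟨k, hk⟩
    refine (surjective_lsmul_or_mem_radical_annihilator hN x).symm.imp_right fun hx =>
      ⟨k, Submodule.mem_annihilator.2 fun z hz => ?_⟩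
    obtain ⟨w, hw⟩ := hx.iterate k ⟨z, hz⟩
    have hwz : x ^ k • w = ⟨z, hz⟩ := (smul_iterate_apply x k w).symm.trans hw
    have hxyw : (x * y) ^ k • (w : L) = 0 := Submodule.mem_annihilator.1 hk w w.2
    rw [mul_pow, mul_comm, mul_smul] at hxyw
    exact (congrArg (y ^ k • ·) (congrArg Subtype.val hwz)).symm.trans hxyw

theorem exists_finset_isPrime_forall_fg_sup_range_eq_top [IsNoetherianRing R] (a : Ideal R)
    (hfg : ∀ t : ℕ, (Submodule.torsionBySet R L (a ^ t : Ideal R)).FG) :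
    ∃ S : Finset (Ideal R), (∀ p ∈ S, p.IsPrime ∧ ¬ a ≤ p) ∧ ∀ x, (∀ p ∈ S, x ∉ p) →
      ∃ F : Submodule R L, F.FG ∧ F ⊔ LinearMap.range (LinearMap.lsmul R L x) = ⊤ := by
  classical
  obtain ⟨s, hs, supIrred⟩ := exists_supIrred_decomposition (⊤ : Submodule R L)
  let torsion (N : Submodule R L) : Prop := a ≤ N.annihilator.radical
  refine ⟨(s.filter (¬ torsion ·)).image fun N => N.annihilator.radical, ?_, fun x hx =>
    ⟨(s.filter torsion).sup id, Submodule.fg_finset_sup _ _ fun N hN => ?_, ?_⟩⟩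
  · simp only [Finset.forall_mem_image, Finset.mem_filter]
    exact fun N hN => ⟨isPrime_radical_annihilator (supIrred hN.1), hN.2⟩
  · obtain ⟨t, ht⟩ := Ideal.exists_pow_le_of_le_radical_of_fg (Finset.mem_filter.1 hN).2
      (IsNoetherian.noetherian a)
    have := isNoetherian_of_fg_of_noetherian _ (hfg t)
    exact isNoetherian_submodule.1 this N fun z hz => (Submodule.mem_torsionBySet_iff _ _).2
      fun y => Submodule.mem_annihilator.1 (ht y.2) z hz
  · refine top_le_iff.1 (hs.ge.trans (Finset.sup_le fun N hN => ?_))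
    by_cases hNa : torsion N
    · exact le_sup_of_le_left (Finset.le_sup (f := id) (Finset.mem_filter.2 ⟨hN, hNa⟩))
    · refine le_sup_of_le_right fun z hz => ?_
      obtain ⟨w, hw⟩ := (surjective_lsmul_or_mem_radical_annihilator (supIrred hN) x).resolve_right
        (hx _ (Finset.mem_image_of_mem _ (Finset.mem_filter.2 ⟨hN, hNa⟩))) ⟨z, hz⟩
      exact ⟨w, congrArg Subtype.val hw⟩

end Secondary

section Support

variable {R : Type*} [CommRing R] {L : Type*} [AddCommGroup L] [Module R L]

lemma mem_support_of_isAssociatedPrime {p : PrimeSpectrum R} (hp : IsAssociatedPrime p.asIdeal L) :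
    p ∈ Module.support R L := by
  obtain ⟨-, m, hm⟩ := hp
  refine Module.mem_support_iff'.2 ⟨m, fun r hr h => hr (hm.ge (Ideal.le_radical ?_))⟩
  exact Submodule.mem_colon_singleton.2 h

lemma finite_setOf_isAssociatedPrime [IsNoetherianRing R] {a : Ideal R} (h : IsPowTorsion a L)
    [Module.Finite R (Submodule.torsionBySet R L a)] :
    {p : PrimeSpectrum R | IsAssociatedPrime p.asIdeal L}.Finite := by
  refine Set.Finite.of_finite_image (f := PrimeSpectrum.asIdeal)
    ((associatedPrimes.finite R (Submodule.torsionBySet R L a)).subset ?_)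
    (fun p _ q _ hpq => PrimeSpectrum.ext hpq)
  rintro _ ⟨p, hp, rfl⟩
  obtain ⟨prime, m, hm⟩ := isAssociatedPrime_iff.1 hp
  have mem_iff (r : R) : r ∈ p.asIdeal ↔ r • m = 0 := by
    rw [hm, Submodule.mem_colon_singleton, Submodule.mem_bot]
  obtain ⟨t, ht⟩ := h m
  have a_le : a ≤ p.asIdeal := prime.le_of_pow_le (n := t) fun x hx => (mem_iff x).2 (ht x hx)
  have m_mem : m ∈ Submodule.torsionBySet R L a :=
    (Submodule.mem_torsionBySet_iff _ _).2 fun x => (mem_iff x).1 (a_le x.2)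
  refine isAssociatedPrime_iff.2 ⟨prime, ⟨m, m_mem⟩, ?_⟩
  ext r
  rw [mem_iff, Submodule.mem_colon_singleton, Submodule.mem_bot, Subtype.ext_iff]
  rfl

lemma exists_isAssociatedPrime_le_of_mem_support [IsNoetherianRing R] {p : PrimeSpectrum R}
    (hp : p ∈ Module.support R L) : ∃ q ≤ p, IsAssociatedPrime q.asIdeal L := by
  obtain ⟨m, hm⟩ := Module.mem_support_iff_exists_annihilator.1 hp
  obtain ⟨q, hq, hqp⟩ := Ideal.exists_minimalPrimes_le hm
  have associated := (Module.associatedPrimes.minimalPrimes_annihilator_subset_associatedPrimes R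
    (Submodule.span R {m}) hq).map_of_injective (Submodule.span R {m}).subtype
      (Submodule.subtype_injective _)
  exact ⟨⟨q, associated.isPrime⟩, hqp, associated⟩

lemma finite_setOf_minimal_support [IsNoetherianRing R] {a : Ideal R} (h : IsPowTorsion a L)
    [Module.Finite R (Submodule.torsionBySet R L a)] :
    {p | Minimal (· ∈ Module.support R L) p}.Finite := by
  refine (finite_setOf_isAssociatedPrime h).subset fun p hp => ?_
  obtain ⟨q, hqp, hq⟩ := exists_isAssociatedPrime_le_of_mem_support hp.1
  exact hp.eq_of_le (mem_support_of_isAssociatedPrime hq) hqp ▸ hq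

lemma mem_support_of_mem_support_quotient_torsionBySet {c : Ideal R} (hc : c.FG)
    {p : PrimeSpectrum R} (hp : p ∈ Module.support R (L ⧸ Submodule.torsionBySet R L c)) :
    p ∈ Module.support R ↥(c • (⊤ : Submodule R L)) := by
  by_contra hcon
  obtain ⟨m, hm⟩ := Module.mem_support_iff'.1 hp
  obtain ⟨m, rfl⟩ := Submodule.Quotient.mk_surjective _ m
  obtain ⟨r, hr, h⟩ := exists_forall_mem_smul_smul_eq_zero p.asIdeal.primeCompl hc (m := m)
    fun x hx => by
      obtain ⟨r, hr, h⟩ := Module.notMem_support_iff'.1 hcon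
        ⟨x • m, Submodule.smul_mem_smul hx trivial⟩
      exact ⟨r, hr, congrArg Subtype.val h⟩
  refine hm r hr ((Submodule.Quotient.mk_eq_zero _).2 ((Submodule.mem_torsionBySet_iff _ _).2 ?_))
  exact fun x => by rw [smul_comm, h x x.2]

lemma notMem_support_smul {c : Ideal R} {N : Submodule R L} {p : PrimeSpectrum R}
    (h : ∀ x ∈ c, ∀ z ∈ N, ∃ r ∉ p.asIdeal, r • x • z = 0) :
    p ∉ Module.support R ↥(c • N) := by
  refine Module.notMem_support_iff'.2 fun ⟨w, hw⟩ => ?_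
  suffices ∃ r ∉ p.asIdeal, r • w = 0 from this.imp fun r h => h.imp_right Subtype.ext
  refine Submodule.smul_induction_on hw h ?_
  rintro v w ⟨r, hr, hv⟩ ⟨s, hs, hw⟩
  refine ⟨r * s, p.isPrime.mul_notMem hr hs, ?_⟩
  rw [smul_add, mul_smul, mul_smul, hw, smul_comm, hv, smul_zero, smul_zero, add_zero]

end Support

section TorsionBySet

variable {R : Type*} [CommRing R] {L : Type*} [AddCommGroup L] [Module R L]

lemma finite_of_smul_le [IsNoetherianRing R] {I : Ideal R} {N K : Submodule R L} (h : I • N ≤ K)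
    [Module.Finite R K] [Module.Finite R (Submodule.torsionBySet R L I)] : Module.Finite R N := by
  let g : N →ₗ[R] I →ₗ[R] K :=
    LinearMap.mk₂ R (fun z x => ⟨(x : R) • (z : L), h (Submodule.smul_mem_smul x.2 z.2)⟩)
      (fun _ _ _ => Subtype.ext (smul_add _ _ _)) (fun _ _ _ => Subtype.ext (smul_comm _ _ _))
      (fun _ _ _ => Subtype.ext (add_smul _ _ _)) (fun _ _ _ => Subtype.ext (mul_smul _ _ _))
  have mem_torsionBySet (z : LinearMap.ker g) : (z : L) ∈ Submodule.torsionBySet R L I :=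
    (Submodule.mem_torsionBySet_iff _ _).2 fun x => congrArg Subtype.val (LinearMap.congr_fun z.2 x)
  have : Module.Finite R (LinearMap.ker g) := Module.Finite.of_injective
    ((N.subtype ∘ₗ (LinearMap.ker g).subtype).codRestrict _ mem_torsionBySet)
    ((LinearMap.injective_codRestrict_iff _).2
      (N.subtype_injective.comp (Submodule.subtype_injective _)))
  have := isNoetherian_of_range_eq_ker (LinearMap.ker g).subtype g (Submodule.range_subtype _)
  infer_instance

lemma finite_torsionBySet_pow [IsNoetherianRing R] (a : Ideal R)
    [Module.Finite R (Submodule.torsionBySet R L a)] (t : ℕ) :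
    Module.Finite R (Submodule.torsionBySet R L (a ^ t : Ideal R)) := by
  induction t with
  | zero =>
    have : Submodule.torsionBySet R L (a ^ 0 : Ideal R) = ⊥ := by
      rw [pow_zero, Ideal.one_eq_top]
      exact Submodule.torsionBySet_univ
    rw [this]
    infer_instance
  | succ t ih =>
    refine finite_of_smul_le (I := a) (K := Submodule.torsionBySet R L (a ^ t : Ideal R))
      (Submodule.smul_le.2 fun x hx z hz => (Submodule.mem_torsionBySet_iff _ _).2 fun y => ?_)
    rw [smul_smul]
    exact (Submodule.mem_torsionBySet_iff _ _).1 hz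
      ⟨y * x, pow_succ a t ▸ Ideal.mul_mem_mul y.2 hx⟩

lemma finite_of_le_annihilator {a : Ideal R} (ha : a ≤ Module.annihilator R L)
    [h : Module.Finite R (Submodule.torsionBySet R L a)] : Module.Finite R L := by
  have : Submodule.torsionBySet R L a = ⊤ := eq_top_iff.2 fun z _ =>
    (Submodule.mem_torsionBySet_iff _ _).2 fun x => Module.mem_annihilator.1 (ha x.2) z
  rw [this] at h
  exact Module.Finite.equiv Submodule.topEquiv

lemma annihilator_lt_annihilator_torsionBy {x : R} (hx : x ∉ Module.annihilator R L) :
    Module.annihilator R L < Module.annihilator R (Submodule.torsionBy R L x) :=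
  lt_of_le_of_ne
    (LinearMap.annihilator_le_of_injective _ (Submodule.torsionBy R L x).subtype_injective)
    fun h => hx (h ▸ Module.mem_annihilator.2 (Submodule.smul_torsionBy x))

lemma IsPowTorsion.of_surjective {a : Ideal R} {M : Type*} [AddCommGroup M] [Module R M]
    (h : IsPowTorsion a L) (f : L →ₗ[R] M) (hf : Function.Surjective f) : IsPowTorsion a M := by
  intro z
  obtain ⟨z, rfl⟩ := hf z
  exact (h z).imp fun t ht x hx => by rw [← map_smul, ht x hx, map_zero]

lemma finite_quotient_of_sup_eq_top {F N : Submodule R L} (hF : F.FG) (h : F ⊔ N = ⊤) :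
    Module.Finite R (L ⧸ N) := by
  have : Module.Finite R F := Module.Finite.iff_fg.2 hF
  refine Module.Finite.of_surjective (N.mkQ ∘ₗ F.subtype) (LinearMap.range_eq_top.1 ?_)
  rw [LinearMap.range_comp, Submodule.range_subtype]
  exact (Submodule.map_mkQ_eq_top N F).2 (sup_comm N F ▸ h)

lemma exists_mem_notMem {a J : Ideal R} (hJ : ¬ a ≤ J) {S : Finset (Ideal R)}
    (hS : ∀ p ∈ S, p.IsPrime ∧ ¬ a ≤ p) : ∃ x ∈ a, x ∉ J ∧ ∀ p ∈ S, x ∉ p := by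
  classical
  by_contra! hcon
  have subset_union : (a : Set R) ⊆ ⋃ p ∈ (insert J S : Finset (Ideal R)), (p : Set R) := by
    intro x hx
    by_cases hxJ : x ∈ J
    · exact Set.mem_biUnion (Finset.mem_insert_self J S) hxJ
    · obtain ⟨p, hp, hxp⟩ := hcon x hx hxJ
      exact Set.mem_biUnion (Finset.mem_insert_of_mem hp) hxp
  obtain ⟨p, hp, hap⟩ := (Ideal.subset_union_prime (f := id) J J fun p hp hpJ _ =>
    (hS p ((Finset.mem_insert.1 hp).resolve_left hpJ)).1).1 subset_union
  obtain rfl | hp := Finset.mem_insert.1 hp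
  · exact hJ hap
  · exact (hS p hp).2 hap

end TorsionBySet

section Cofinite

variable {R : Type u} [CommRing R]

lemma prop_ker_postcomp {P : ObjectProperty (ModuleCat.{u} R)} [P.IsSerreClass]
    {X : ModuleCat.{u} R} {A B C : Type u} [AddCommGroup A] [Module R A] [AddCommGroup B]
    [Module R B] [AddCommGroup C] [Module R C] {f : A →ₗ[R] B} {g : B →ₗ[R] C}
    (hf : Function.Injective f) (hfg : Function.Exact f g) (hg : Function.Surjective g) (k : ℕ)
    (hC : ∀ j < k, P (extModule X j C)) :
    P (ModuleCat.of R (LinearMap.ker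
      ((Ext.mk₀ (ModuleCat.ofHom f)).postcompOfLinear R X (add_zero k)))) := by
  cases k with
  | zero =>
    have : Mono (ModuleCat.ofHom f) := (ModuleCat.mono_iff_injective _).2 hf
    rw [LinearMap.ker_eq_bot.2 (Ext.postcomp_mk₀_injective_of_mono X (ModuleCat.ofHom f))]
    exact prop_of_subsingleton P _
  | succ j =>
    have hS := ModuleCat.shortComplex_shortExact
      (ShortComplex.moduleCatMk f g hfg.linearMap_comp_eq_zero) hfg hf hg
    let δ : extModule X j C →ₗ[R] extModule X (j + 1) A := hS.extClass.postcompOfLinear R X rfl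
    have ker_le : LinearMap.ker ((Ext.mk₀ (ModuleCat.ofHom f)).postcompOfLinear R X
        (add_zero (j + 1))) ≤ LinearMap.range δ := fun ξ hξ =>
      Ext.covariant_sequence_exact₁ _ hS ξ hξ rfl
    exact prop_of_injective P (B := ModuleCat.of R (LinearMap.range δ))
      (Submodule.inclusion ker_le) (Submodule.inclusion_injective ker_le)
      (prop_of_surjective P δ.rangeRestrict δ.surjective_rangeRestrict (hC j (Nat.lt_succ_self j)))

lemma exact_torsionBy_rangeRestrict (L : Type*) [AddCommGroup L] [Module R L] (x : R) :
    Function.Exact (Submodule.torsionBy R L x).subtype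
      (LinearMap.lsmul R L x).rangeRestrict := fun z => by
  simp [Subtype.ext_iff]

lemma prop_ext_of_torsionBy {P : ObjectProperty (ModuleCat.{u} R)} [P.IsSerreClass]
    {X : ModuleCat.{u} R} {L : Type u} [AddCommGroup L] [Module R L] {x : R}
    (hx : x ∈ Module.annihilator R X) (k : ℕ) (hK : P (extModule X k (Submodule.torsionBy R L x)))
    (hC : ∀ j < k, P (extModule X j (L ⧸ LinearMap.range (LinearMap.lsmul R L x)))) :
    P (extModule X k L) := by
  let μ : L →ₗ[R] L := LinearMap.lsmul R L x
  have exact_ker := exact_torsionBy_rangeRestrict L x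
  have hS := ModuleCat.shortComplex_shortExact
    (ShortComplex.moduleCatMk _ _ exact_ker.linearMap_comp_eq_zero) exact_ker
      (Submodule.subtype_injective _) μ.surjective_rangeRestrict
  let α : extModule X k L →ₗ[R] extModule X k (LinearMap.range μ) :=
    (Ext.mk₀ (ModuleCat.ofHom μ.rangeRestrict)).postcompOfLinear R X (add_zero k)
  let β : extModule X k (LinearMap.range μ) →ₗ[R] extModule X k L :=
    (Ext.mk₀ (ModuleCat.ofHom (LinearMap.range μ).subtype)).postcompOfLinear R X (add_zero k)
  have β_α (ξ : extModule X k L) : β (α ξ) = 0 := by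
    have factor : ModuleCat.ofHom μ.rangeRestrict ≫ ModuleCat.ofHom (LinearMap.range μ).subtype =
        x • 𝟙 (ModuleCat.of R L) := rfl
    change (Ext.comp ξ _ (add_zero k)).comp _ (add_zero k) = _
    rw [Ext.comp_assoc_of_third_deg_zero, Ext.mk₀_comp_mk₀, factor, ← Ext.smul_eq_comp_mk₀,
      smul_ext_eq_zero hx]
  refine prop_of_ker_le_range P (C := ModuleCat.of R (LinearMap.ker β))
    (f := (Ext.mk₀ (ModuleCat.ofHom (Submodule.torsionBy R L x).subtype)).postcompOfLinear R X
      (add_zero k))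
    (g := α.codRestrict (LinearMap.ker β) β_α) (fun ξ hξ => ?_) hK
    (prop_ker_postcomp (Submodule.subtype_injective _) (LinearMap.exact_subtype_mkQ _)
      (Submodule.mkQ_surjective _) k hC)
  exact Ext.covariant_sequence_exact₂ _ hS ξ (congrArg Subtype.val hξ)

variable {a : Ideal R}

lemma finite_extQuot_zero_iff {L : Type u} [AddCommGroup L] [Module R L] :
    Module.Finite R (extQuot a 0 L) ↔ Module.Finite R (Submodule.torsionBySet R L a) :=
  Module.Finite.equiv_iff (extZeroEquiv a (ModuleCat.of R L))

lemma finite_torsionBySet_of_injective [IsNoetherianRing R] {L M : Type*} [AddCommGroup L]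
    [Module R L] [AddCommGroup M] [Module R M] (f : M →ₗ[R] L) (hf : Function.Injective f)
    [Module.Finite R (Submodule.torsionBySet R L a)] :
    Module.Finite R (Submodule.torsionBySet R M a) :=
  Module.Finite.of_injective ((f ∘ₗ Submodule.subtype _).codRestrict _ fun z =>
      (Submodule.mem_torsionBySet_iff _ _).2 fun x => by
        rw [LinearMap.comp_apply, ← map_smul, Submodule.subtype_apply,
          (Submodule.mem_torsionBySet_iff _ _).1 z.2 x, map_zero])
    ((LinearMap.injective_codRestrict_iff _).2 (hf.comp (Submodule.subtype_injective _)))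

theorem finite_extQuot_of_support_isMaximal [IsNoetherianRing R] {L : Type u} [AddCommGroup L]
    [Module R L] (htor : IsPowTorsion a L) (hsupp : ∀ p ∈ Module.support R L, p.asIdeal.IsMaximal)
    [Module.Finite R (Submodule.torsionBySet R L a)] (k : ℕ) :
    Module.Finite R (extQuot a k L) := by
  induction h : Module.annihilator R L using WellFoundedGT.induction generalizing L k with | _ J ih
  subst h
  by_cases haJ : a ≤ Module.annihilator R L
  · have := finite_of_le_annihilator haJ
    infer_instance
  have : IsArtinian R (Submodule.torsionBySet R L a) := isArtinian_of_support fun p hp =>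
    hsupp p (Module.support_subset_of_injective _ (Submodule.subtype_injective _) hp)
  have : IsArtinian R L := isArtinian_of_torsionBySet (IsNoetherian.noetherian a) htor
  obtain ⟨S, hS, exists_fg⟩ := exists_finset_isPrime_forall_fg_sup_range_eq_top (L := L) a fun t =>
    Module.Finite.iff_fg.1 (finite_torsionBySet_pow a t)
  obtain ⟨x, hxa, hxJ, hxS⟩ := exists_mem_notMem haJ hS
  obtain ⟨F, hF, sup_eq_top⟩ := exists_fg x hxS
  have := finite_quotient_of_sup_eq_top hF sup_eq_top
  have inj := (Submodule.torsionBy R L x).subtype_injective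
  have := finite_torsionBySet_of_injective (a := a) _ inj
  exact prop_ext_of_torsionBy (P := ModuleCat.isFG R) (Ideal.annihilator_quotient.ge hxa) k
    (ih _ (annihilator_lt_annihilator_torsionBy hxJ) (htor.of_injective _ inj)
      (fun p hp => hsupp p (Module.support_subset_of_injective _ inj hp)) k rfl)
    fun j _ => inferInstanceAs (Module.Finite R (extQuot a j _))

end Cofinite

section Localized

variable {R : Type*} [CommRing R] {L : Type*} [AddCommGroup L] [Module R L]

lemma mem_support_localizedModule_iff {S : Submonoid R} {Q : PrimeSpectrum (Localization S)} :
    Q ∈ Module.support (Localization S) (LocalizedModule S L) ↔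
      PrimeSpectrum.comap (algebraMap R (Localization S)) Q ∈ Module.support R L := by
  refine ⟨fun hQ => ?_, fun hQ => ?_⟩
  · obtain ⟨z, hz⟩ := Module.mem_support_iff'.1 hQ
    induction z with | _ m s
    refine Module.mem_support_iff'.2 ⟨m, fun r hr h => hz (algebraMap R _ r) hr ?_⟩
    rw [algebraMap_smul, LocalizedModule.smul'_mk, h, LocalizedModule.zero_mk]
  · obtain ⟨m, hm⟩ := Module.mem_support_iff'.1 hQ
    refine Module.mem_support_iff'.2 ⟨LocalizedModule.mk m 1, fun r hr h => ?_⟩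
    induction r with | _ rs
    obtain ⟨r, s⟩ := rs
    rw [LocalizedModule.mk_smul_mk, localizedModule_mk_eq_zero_iff] at h
    obtain ⟨u, hu, h⟩ := h
    refine hm (u * r) (fun hur => hr ?_) (by rw [mul_smul, h])
    have unit_u := IsLocalization.map_units (Localization S) ⟨u, hu⟩
    rw [PrimeSpectrum.comap_asIdeal, Ideal.mem_comap, map_mul, Ideal.unit_mul_mem_iff_mem _ unit_u]
      at hur
    rw [Localization.mk_eq_mk', IsLocalization.mk'_eq_mul_mk'_one]
    exact Q.asIdeal.mul_mem_right _ hur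

/-- Localization commutes with multiplication by an ideal: `(c S⁻¹R)(S⁻¹L) ≃ S⁻¹(cL)`. -/
noncomputable def smulLocalizedEquiv (S : Submonoid R) (c : Ideal R) (L : Type*) [AddCommGroup L]
    [Module R L] : ↥(c.map (algebraMap R (Localization S)) •
        (⊤ : Submodule (Localization S) (LocalizedModule S L))) ≃ₗ[Localization S]
      LocalizedModule S ↥(c • (⊤ : Submodule R L)) :=
  (LinearEquiv.ofEq _ _ (by
    rw [Submodule.localized, Submodule.localized'_smul, Submodule.localized'_top,
      Ideal.localized'_eq_map])).trans (Submodule.localizedEquiv S (c • (⊤ : Submodule R L)))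

lemma comap_closedPoint (p : PrimeSpectrum R) :
    PrimeSpectrum.comap (algebraMap R (Localization.AtPrime p.asIdeal))
      (IsLocalRing.closedPoint _) = p :=
  PrimeSpectrum.ext (IsLocalization.AtPrime.under_maximalIdeal _ p.asIdeal)

lemma isMaximal_of_mem_support_localized {p : PrimeSpectrum R}
    (hp : Minimal (· ∈ Module.support R L) p)
    {Q : PrimeSpectrum (Localization.AtPrime p.asIdeal)}
    (hQ : Q ∈ Module.support _ (LocalizedModule p.asIdeal.primeCompl L)) : Q.asIdeal.IsMaximal := by
  let A := Localization.AtPrime p.asIdeal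
  have comap_le : PrimeSpectrum.comap (algebraMap R A) Q ≤ p :=
    (Ideal.comap_mono (IsLocalRing.le_maximalIdeal Q.isPrime.ne_top)).trans (comap_closedPoint p).le
  have comap_eq := hp.eq_of_le (mem_support_localizedModule_iff.1 hQ) comap_le
  rw [PrimeSpectrum.localization_comap_injective _ p.asIdeal.primeCompl
    (comap_eq.trans (comap_closedPoint p).symm)]
  exact IsLocalRing.maximalIdeal.isMaximal _

lemma IsPowTorsion.localized {a : Ideal R} (h : IsPowTorsion a L) (S : Submonoid R) :
    IsPowTorsion (a.map (algebraMap R (Localization S))) (LocalizedModule S L) := by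
  intro z
  induction z with | _ m s
  obtain ⟨t, ht⟩ := h m
  refine ⟨t, fun x hx => ?_⟩
  have mem_torsionBySet : LocalizedModule.mk m s ∈ Submodule.torsionBySet (Localization S)
      (LocalizedModule S L) ((a ^ t).map (algebraMap R (Localization S))) :=
    mem_torsionBySet_map_iff.2 fun y hy => by
      rw [LocalizedModule.smul'_mk, ht y hy, LocalizedModule.zero_mk]
  rw [Ideal.map_pow] at mem_torsionBySet
  exact (Submodule.mem_torsionBySet_iff _ _).1 mem_torsionBySet ⟨x, hx⟩

lemma smul_mk_mem_range_lsmul {U : Submonoid R} {x y : R} {z w : L} {s : U}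
    (h : y • LocalizedModule.mk z (1 : U) = y • x • LocalizedModule.mk w s) :
    ∃ r ∈ U, r • y • z ∈ LinearMap.range (LinearMap.lsmul R L x) := by
  rw [LocalizedModule.smul'_mk, LocalizedModule.smul'_mk, LocalizedModule.smul'_mk,
    LocalizedModule.mk_eq] at h
  obtain ⟨u, hu⟩ := h
  simp only [Submonoid.smul_def, one_smul] at hu
  refine ⟨u * s, U.mul_mem u.2 s.2, (u : R) • y • w, ?_⟩
  rw [LinearMap.lsmul_apply, mul_smul, hu, smul_comm x (u : R), smul_comm x y]

variable [IsNoetherianRing R]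

lemma finite_torsionBySet_localized (S : Submonoid R) (I : Ideal R)
    [Module.Finite R (Submodule.torsionBySet R L I)] :
    Module.Finite (Localization S) (Submodule.torsionBySet (Localization S) (LocalizedModule S L)
      (I.map (algebraMap R (Localization S)))) := by
  rw [torsionBySet_localized S L (IsNoetherian.noetherian I)]
  exact Module.Finite.iff_fg.2 (Submodule.localized_fg S (Module.Finite.iff_fg.1 ‹_›))

lemma isArtinian_localizedModule {a : Ideal R} (htor : IsPowTorsion a L)
    [Module.Finite R (Submodule.torsionBySet R L a)] {p : PrimeSpectrum R}
    (hp : Minimal (· ∈ Module.support R L) p) :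
    IsArtinian (Localization.AtPrime p.asIdeal) (LocalizedModule p.asIdeal.primeCompl L) := by
  let A := Localization.AtPrime p.asIdeal
  let c : Ideal A := a.map (algebraMap R A)
  have : Module.Finite A (Submodule.torsionBySet A (LocalizedModule p.asIdeal.primeCompl L) c) :=
    finite_torsionBySet_localized _ a
  have : IsNoetherianRing A := IsLocalization.isNoetherianRing p.asIdeal.primeCompl A inferInstance
  have := isArtinian_of_support fun Q hQ => isMaximal_of_mem_support_localized hp
    (Module.support_subset_of_injective _ (Submodule.torsionBySet A _ c).subtype_injective hQ)
  exact isArtinian_of_torsionBySet (IsNoetherian.noetherian c) (htor.localized _)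

theorem exists_finset_isPrime_forall_notMem_support {a : Ideal R} (htor : IsPowTorsion a L)
    [Module.Finite R (Submodule.torsionBySet R L a)] {p : PrimeSpectrum R}
    (hp : Minimal (· ∈ Module.support R L) p) :
    ∃ S : Finset (Ideal R), (∀ q ∈ S, q.IsPrime ∧ ¬ a ≤ q) ∧ ∀ x, (∀ q ∈ S, x ∉ q) →
      ∃ t : ℕ, p ∉ Module.support R
        ↥(a ^ t • (⊤ : Submodule R (L ⧸ LinearMap.range (LinearMap.lsmul R L x)))) := by
  classical
  let U := p.asIdeal.primeCompl
  let A := Localization.AtPrime p.asIdeal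
  let c : Ideal A := a.map (algebraMap R A)
  have htor' : IsPowTorsion c (LocalizedModule U L) := htor.localized U
  have : Module.Finite A (Submodule.torsionBySet A (LocalizedModule U L) c) :=
    finite_torsionBySet_localized U a
  have : IsNoetherianRing A := IsLocalization.isNoetherianRing U A inferInstance
  have : IsArtinian A (LocalizedModule U L) := isArtinian_localizedModule htor hp
  obtain ⟨S, hS, exists_fg⟩ := exists_finset_isPrime_forall_fg_sup_range_eq_top
    (L := LocalizedModule U L) c fun t => Module.Finite.iff_fg.1 (finite_torsionBySet_pow c t)
  refine ⟨S.image (Ideal.comap (algebraMap R A)), ?_, fun x hx => ?_⟩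
  · simp only [Finset.forall_mem_image]
    exact fun q hq => ⟨(hS q hq).1.comap _, fun h => (hS q hq).2 (Ideal.map_le_iff_le_comap.2 h)⟩
  obtain ⟨F, hF, sup_eq_top⟩ := exists_fg (algebraMap R A x) fun q hq =>
    hx _ (Finset.mem_image_of_mem _ hq)
  obtain ⟨t, ht⟩ := exists_pow_smul_eq_zero_of_fg hF fun z _ =>
    mem_primaryComponent_iff.2 (htor' z)
  refine ⟨t, notMem_support_smul fun y hy z _ => ?_⟩
  obtain ⟨z, rfl⟩ := Submodule.mkQ_surjective _ z
  obtain ⟨f, hf, _, ⟨w, rfl⟩, add_eq⟩ := Submodule.mem_sup.1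
    (sup_eq_top.ge trivial : LocalizedModule.mk z (1 : U) ∈ _)
  have smul_f : y • f = 0 := by
    rw [← algebraMap_smul A y f]
    exact ht _ (Ideal.map_pow (algebraMap R A) a t ▸ Ideal.mem_map_of_mem _ hy) f hf
  induction w with | _ w s
  obtain ⟨r, hr, mem_range⟩ := smul_mk_mem_range_lsmul (x := x) (y := y) (z := z) (w := w) (s := s)
    (by rw [← add_eq, smul_add, smul_f, zero_add, LinearMap.lsmul_apply, algebraMap_smul])
  refine ⟨r, hr, ?_⟩
  rw [← map_smul, ← map_smul]
  exact (Submodule.Quotient.mk_eq_zero _).2 mem_range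

end Localized

section Cofinite

variable {R : Type u} [CommRing R] {L : Type u} [AddCommGroup L] [Module R L]

section SerreClass

variable {P : ObjectProperty (ModuleCat.{u} R)} [P.IsSerreClass] {X : ModuleCat.{u} R} {x : R}

lemma prop_ext_one_torsionBy (h₀ : P (extModule X 0 L)) (h₁ : P (extModule X 1 L)) :
    P (extModule X 1 (Submodule.torsionBy R L x)) :=
  prop_ext_left (Submodule.subtype_injective _) (exact_torsionBy_rangeRestrict L x)
    (LinearMap.surjective_rangeRestrict _) 0
    (prop_ext_zero_of_injective (Submodule.subtype_injective _) h₀) h₁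

lemma prop_ext_zero_quotient_range_lsmul (h₀ : P (extModule X 0 L)) (h₁ : P (extModule X 1 L))
    (hK : P (extModule X 2 (Submodule.torsionBy R L x))) :
    P (extModule X 0 (L ⧸ LinearMap.range (LinearMap.lsmul R L x))) :=
  prop_ext_right (Submodule.subtype_injective _) (LinearMap.exact_subtype_mkQ _)
    (Submodule.mkQ_surjective _) 0 h₀
    (prop_ext_right (Submodule.subtype_injective _) (exact_torsionBy_rangeRestrict L x)
      (LinearMap.surjective_rangeRestrict _) 1 h₁ hK)

end SerreClass

variable [IsNoetherianRing R] {a : Ideal R}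

lemma finite_extQuot_of_support_pow_smul (htor : IsPowTorsion a L) (t : ℕ)
    (hsupp : ∀ p ∈ Module.support R ↥(a ^ t • (⊤ : Submodule R L)), p.asIdeal.IsMaximal)
    [Module.Finite R (Submodule.torsionBySet R L a)] (k : ℕ) : Module.Finite R (extQuot a k L) := by
  let W := Submodule.torsionBySet R L (a ^ t : Ideal R)
  have : Module.Finite R W := finite_torsionBySet_pow a t
  have finite_zero : Module.Finite R (extQuot a 0 (L ⧸ W)) :=
    prop_ext_right (P := ModuleCat.isFG R) W.subtype_injective (LinearMap.exact_subtype_mkQ W)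
      W.mkQ_surjective 0 (finite_extQuot_zero_iff.2 ‹_›)
      (inferInstanceAs (Module.Finite R (extQuot a 1 W)))
  have := finite_extQuot_zero_iff.1 finite_zero
  have finite_quotient : Module.Finite R (extQuot a k (L ⧸ W)) :=
    finite_extQuot_of_support_isMaximal (htor.of_surjective _ W.mkQ_surjective)
      (fun p hp => hsupp p (mem_support_of_mem_support_quotient_torsionBySet
        (IsNoetherian.noetherian _) hp)) k
  exact prop_ext_middle (P := ModuleCat.isFG R) W.subtype_injective (LinearMap.exact_subtype_mkQ W)
    W.mkQ_surjective k (inferInstanceAs (Module.Finite R (extQuot a k W))) finite_quotient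

lemma exists_mem_notMem_support_pow_smul {L : Type*} [AddCommGroup L] [Module R L]
    (htor : IsPowTorsion a L) {J : Ideal R} (hJ : ¬ a ≤ J)
    [Module.Finite R (Submodule.torsionBySet R L a)] :
    ∃ x ∈ a, x ∉ J ∧ ∃ t : ℕ, ∀ p, Minimal (· ∈ Module.support R L) p → p ∉ Module.support R
      ↥(a ^ t • (⊤ : Submodule R (L ⧸ LinearMap.range (LinearMap.lsmul R L x)))) := by
  classical
  let T := (finite_setOf_minimal_support htor).toFinset
  have mem_T {p} : p ∈ T ↔ Minimal (· ∈ Module.support R L) p := Set.Finite.mem_toFinset _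
  choose! S hS hx using fun p hp =>
    exists_finset_isPrime_forall_notMem_support htor (mem_T.1 hp : Minimal _ p)
  obtain ⟨x, hxa, hxJ, hxS⟩ := exists_mem_notMem hJ (S := T.biUnion S) fun q hq => by
    obtain ⟨p, hp, hqp⟩ := Finset.mem_biUnion.1 hq
    exact hS p hp q hqp
  choose! t ht using fun p hp => hx p hp x fun q hq => hxS q (Finset.mem_biUnion.2 ⟨p, hp, hq⟩)
  refine ⟨x, hxa, hxJ, T.sup t, fun p hp hmem => ht p (mem_T.2 hp) ?_⟩
  have le := Submodule.smul_mono_left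
    (N := (⊤ : Submodule R (L ⧸ LinearMap.range (LinearMap.lsmul R L x))))
    (Ideal.pow_le_pow_right (I := a) (Finset.le_sup (f := t) (mem_T.2 hp)))
  exact Module.support_subset_of_injective _ (Submodule.inclusion_injective le) hmem

theorem finite_extQuot_of_support (htor : IsPowTorsion a L)
    (hsupp : ∀ p ∈ Module.support R L, ∀ q, p < q → q.asIdeal.IsMaximal)
    (h₀ : Module.Finite R (extQuot a 0 L)) (h₁ : Module.Finite R (extQuot a 1 L)) (k : ℕ) :
    Module.Finite R (extQuot a k L) := by
  induction h : Module.annihilator R L using WellFoundedGT.induction generalizing L k with | _ J ih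
  subst h
  have := finite_extQuot_zero_iff.1 h₀
  by_cases haJ : a ≤ Module.annihilator R L
  · have := finite_of_le_annihilator haJ
    infer_instance
  obtain ⟨x, hxa, hxJ, t, ht⟩ := exists_mem_notMem_support_pow_smul htor haJ
  have inj := (Submodule.torsionBy R L x).subtype_injective
  have finite_torsionBy := ih _ (annihilator_lt_annihilator_torsionBy hxJ)
    (htor.of_injective _ inj) (fun p hp => hsupp p (Module.support_subset_of_injective _ inj hp))
    (prop_ext_zero_of_injective (P := ModuleCat.isFG R) inj h₀)
    (prop_ext_one_torsionBy (P := ModuleCat.isFG R) h₀ h₁) (h := rfl)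
  have finite_zero : Module.Finite R
      (extQuot a 0 (L ⧸ LinearMap.range (LinearMap.lsmul R L x))) :=
    prop_ext_zero_quotient_range_lsmul (P := ModuleCat.isFG R) h₀ h₁ (finite_torsionBy 2)
  have := finite_extQuot_zero_iff.1 finite_zero
  have surj := (LinearMap.range (LinearMap.lsmul R L x)).mkQ_surjective
  refine prop_ext_of_torsionBy (P := ModuleCat.isFG R) (Ideal.annihilator_quotient.ge hxa) k
    (finite_torsionBy k) fun j _ => finite_extQuot_of_support_pow_smul
      (htor.of_surjective _ surj) t (fun p hp => ?_) j
  by_contra not_isMaximal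
  have mem_support : p ∈ Module.support R L := Module.support_subset_of_surjective _ surj
    (Module.support_subset_of_injective _ (Submodule.subtype_injective _) hp)
  refine ht p ⟨mem_support, fun q hq hqp => ?_⟩ hp
  by_contra hpq
  exact not_isMaximal (hsupp q hq p (lt_of_le_not_ge hqp hpq))

end Cofinite

section Invariants

lemma lt_iInf_natCast_iff {Q : ℕ → Prop} {r : ℕ∞} :
    r < ⨅ (i : ℕ) (_ : Q i), (i : ℕ∞) ↔ r ≠ ⊤ ∧ ∀ i : ℕ, (i : ℕ∞) ≤ r → ¬ Q i := by
  induction r with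
  | top => simp
  | coe n =>
    rw [← ENat.add_one_le_iff (ENat.natCast_ne_top n), le_iInf₂_iff]
    refine ⟨fun h => ⟨ENat.natCast_ne_top n, fun i hi hQ => ?_⟩, fun h i hQ => ?_⟩
    · have := h i hQ
      norm_cast at this hi
      omega
    · have := mt (h.2 i) (not_not.2 hQ)
      norm_cast at this ⊢
      omega

lemma le_iInf_natCast_iff {Q : ℕ → Prop} {r : ℕ∞} :
    r ≤ ⨅ (i : ℕ) (_ : Q i), (i : ℕ∞) ↔ ∀ i : ℕ, (i : ℕ∞) < r → ¬ Q i := by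
  rw [le_iInf₂_iff]
  exact ⟨fun h i hi hQ => absurd (h i hQ) (not_le.2 hi), fun h i hQ =>
    not_lt.1 fun hi => h i hi hQ⟩

end Invariants

section Vanishing

variable {R : Type u} [CommRing R] {a : Ideal R}

lemma IsPowTorsion.subsingleton_of_torsionBySet {L : Type*} [AddCommGroup L] [Module R L]
    (htor : IsPowTorsion a L) [Subsingleton (Submodule.torsionBySet R L a)] : Subsingleton L := by
  have eq_zero (z : L) (hz : ∀ x ∈ a, x • z = 0) : z = 0 :=
    congrArg Subtype.val (Subsingleton.elim
      (⟨z, (Submodule.mem_torsionBySet_iff _ _).2 fun x => hz x x.2⟩ :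
        Submodule.torsionBySet R L a) 0)
  have eq_zero_of_pow (t : ℕ) : ∀ z : L, (∀ x ∈ a ^ t, x • z = 0) → z = 0 := by
    induction t with
    | zero => exact fun z hz => by simpa using hz 1 (by simp)
    | succ t ih =>
      refine fun z hz => eq_zero z fun x hx => ih _ fun y hy => ?_
      rw [smul_smul]
      exact hz _ (pow_succ a t ▸ Ideal.mul_mem_mul hy hx)
  exact subsingleton_of_forall_eq 0 fun z => (htor z).elim fun t ht => eq_zero_of_pow t z ht

lemma IsPowTorsion.subsingleton_of_extQuot_zero {L : Type u} [AddCommGroup L] [Module R L]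
    (htor : IsPowTorsion a L) (_ : Subsingleton (extQuot a 0 L)) : Subsingleton L :=
  have := (extZeroEquiv a (ModuleCat.of R L)).symm.toEquiv.subsingleton
  htor.subsingleton_of_torsionBySet

variable [IsNoetherianRing R] {M : Type u} [AddCommGroup M] [Module R M]

theorem subsingleton_localCohomology_of_extQuot {i : ℕ}
    (h : ∀ j ≤ i, Subsingleton (extQuot a j M)) : Subsingleton (H a i M) := by
  let P : ObjectProperty (ModuleCat.{u} R) := IsZero
  have isZero_ext (j : ℕ) (hj : j ≤ i) : P (extQuot a j M) :=
    ModuleCat.isZero_of_iff_subsingleton.2 (h j hj)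
  have subsingleton_primaryComponent : Subsingleton (a.primaryComponent M) :=
    (isPowTorsion_primaryComponent a M).subsingleton_of_extQuot_zero
      (ModuleCat.isZero_of_iff_subsingleton.1 (prop_ext_zero_of_injective (P := P)
        (a.primaryComponent M).subtype_injective (isZero_ext 0 i.zero_le)))
  induction i using Nat.strong_induction_on with | _ i ih
  cases i with
  | zero => exact (localCohomologyZeroEquiv a M).toEquiv.subsingleton
  | succ i =>
    refine (isPowTorsion_localCohomology a (i + 1) M).subsingleton_of_extQuot_zero
      (ModuleCat.isZero_of_iff_subsingleton.1 ((prop_ext_localCohomology_succ (P := P) i M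
        (fun k => prop_ext_of_subsingleton _) fun j hj k => ?_).1 (isZero_ext _ le_rfl)))
    have := ih (j + 1) (Nat.succ_lt_succ hj) (fun l hl => h l (by omega))
      fun l hl => isZero_ext l (by omega)
    exact prop_ext_of_subsingleton k

lemma support_localCohomology_subset (a : Ideal R) (i : ℕ) (M : Type u) [AddCommGroup M]
    [Module R M] : Module.support R (H a i M) ⊆ Module.support R M := by
  intro p hp
  by_contra hpM
  have : Subsingleton (locModule p M) := Module.notMem_support_iff.1 hpM
  have : IsNoetherianRing (Localization.AtPrime p.asIdeal) :=
    IsLocalization.isNoetherianRing p.asIdeal.primeCompl _ inferInstance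
  have : Subsingleton (H (locIdeal p a) i (locModule p M)) :=
    subsingleton_localCohomology_of_extQuot fun j _ => ModuleCat.isZero_of_iff_subsingleton.1
      (prop_ext_of_subsingleton (P := IsZero) j)
  obtain ⟨e⟩ := nonempty_localized_localCohomology_equiv p.asIdeal.primeCompl a i M
  exact Module.notMem_support_iff.2 e.toEquiv.subsingleton hp

lemma gradeOn_le_finitenessDim [Module.Finite R M] (ha : a • (⊤ : Submodule R M) ≠ ⊤) :
    gradeOn a M ≤ finitenessDim a M := by
  refine iSup₂_le fun rs hrs => le_iInf_natCast_iff.2 fun i hi => not_not.2 ?_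
  have lt_length : i < rs.length := by exact_mod_cast hi
  have support_subset : Module.support R (R ⧸ a) ⊆ PrimeSpectrum.zeroLocus a := by
    rw [Module.support_eq_zeroLocus, Ideal.annihilator_quotient]
  have : Subsingleton (H a i M) := subsingleton_localCohomology_of_extQuot fun j hj =>
    ModuleCat.subsingleton_ext_of_exists_isRegular a (ModuleCat.of R (R ⧸ a)) support_subset
      (ModuleCat.of R M) (lt_top_iff_ne_top.2 ha) rs hrs.1 hrs.2 j (hj.trans_lt lt_length)
  infer_instance

end Vanishing

section FinitenessDimension

variable {R : Type u} [CommRing R]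

section PowTorsion

variable {a : Ideal R} {L : Type*} [AddCommGroup L] [Module R L]

lemma IsPowTorsion.exists_pow_smul_top_eq_bot (htor : IsPowTorsion a L) [Module.Finite R L] :
    ∃ t : ℕ, a ^ t • (⊤ : Submodule R L) = ⊥ := by
  obtain ⟨t, ht⟩ := exists_pow_smul_eq_zero_of_fg (Module.Finite.fg_top (R := R) (M := L))
    fun z _ => mem_primaryComponent_iff.2 (htor z)
  exact ⟨t, eq_bot_iff.2 (Submodule.smul_le.2 ht)⟩

lemma IsPowTorsion.le_of_mem_support (htor : IsPowTorsion a L) {p : PrimeSpectrum R}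
    (hp : p ∈ Module.support R L) : a ≤ p.asIdeal := by
  intro x hx
  obtain ⟨z, hz⟩ := Module.mem_support_iff'.1 hp
  obtain ⟨t, ht⟩ := htor z
  by_contra hxp
  exact hz (x ^ t) (fun h => hxp (p.isPrime.mem_of_pow_mem t h)) (ht _ (Ideal.pow_mem_pow hx t))

lemma IsPowTorsion.exists_notMem_support_pow_smul (htor : IsPowTorsion a L) (p : PrimeSpectrum R)
    [Module.Finite (Localization.AtPrime p.asIdeal) (LocalizedModule p.asIdeal.primeCompl L)] :
    ∃ t : ℕ, p ∉ Module.support R ↥(a ^ t • (⊤ : Submodule R L)) := by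
  obtain ⟨t, ht⟩ := (htor.localized p.asIdeal.primeCompl).exists_pow_smul_top_eq_bot
  refine ⟨t, fun hp => ?_⟩
  rw [← comap_closedPoint p, ← mem_support_localizedModule_iff,
    ← (smulLocalizedEquiv _ (a ^ t) L).support_eq, Ideal.map_pow, ht] at hp
  exact Module.notMem_support_iff.2 inferInstance hp

end PowTorsion

variable [IsNoetherianRing R] {a : Ideal R} {M : Type u} [AddCommGroup M] [Module R M]

lemma exists_notMem_support_pow_smul_localCohomology [Module.Finite R M] {n i : ℕ}
    (hi : (i : ℕ∞) < nthFinitenessDim n a M) {p : PrimeSpectrum R}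
    (hp : (n : WithBot ℕ∞) ≤ ringKrullDim (R ⧸ p.asIdeal)) :
    ∃ t : ℕ, p ∉ Module.support R ↥(a ^ t • (⊤ : Submodule R (H a i M))) := by
  have htor := isPowTorsion_localCohomology a i M
  by_cases mem_support : p ∈ Module.support R (M ⧸ a • (⊤ : Submodule R M))
  · have lt_finitenessDim : i < finitenessDim (locIdeal p a) (locModule p M) :=
      hi.trans_le (iInf₂_le p ⟨mem_support, hp⟩)
    have : Module.Finite _ (H (locIdeal p a) i (locModule p M)) :=
      not_not.1 ((lt_iInf_natCast_iff.1 lt_finitenessDim).2 i le_rfl)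
    obtain ⟨e⟩ := nonempty_localized_localCohomology_equiv p.asIdeal.primeCompl a i M
    have := Module.Finite.equiv e.symm
    exact htor.exists_notMem_support_pow_smul p
  · refine ⟨0, fun h => mem_support ?_⟩
    have mem_support_H : p ∈ Module.support R (H a i M) :=
      Module.support_subset_of_injective _ (Submodule.subtype_injective _) h
    rw [Module.support_quotient]
    exact ⟨support_localCohomology_subset a i M mem_support_H, htor.le_of_mem_support mem_support_H⟩

lemma one_le_finitenessDim [Module.Finite R M] : 1 ≤ finitenessDim a M := by
  refine le_iInf_natCast_iff.2 fun i hi => not_not.2 ?_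
  obtain rfl := Nat.cast_eq_zero.1 (Order.lt_one_iff.1 hi)
  exact Module.Finite.equiv (localCohomologyZeroEquiv a M).symm

lemma finitenessDim_le_nthFinitenessDim (n : ℕ) : finitenessDim a M ≤ nthFinitenessDim n a M := by
  refine le_iInf₂ fun p _ => le_iInf_natCast_iff.2 fun i hi => not_not.2 ?_
  have : Module.Finite R (H a i M) := not_not.1 ((lt_iInf_natCast_iff.1 hi).2 i le_rfl)
  obtain ⟨e⟩ := nonempty_localized_localCohomology_equiv p.asIdeal.primeCompl a i M
  have := Module.Finite.of_isLocalizedModule p.asIdeal.primeCompl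
    (Rₚ := Localization.AtPrime p.asIdeal)
    (LocalizedModule.mkLinearMap p.asIdeal.primeCompl (H a i M))
  exact Module.Finite.equiv e

end FinitenessDimension

lemma nthFinitenessDim_mono {R : Type u} [CommRing R] (a : Ideal R) (M : Type u) [AddCommGroup M]
    [Module R M] : Monotone fun n => nthFinitenessDim n a M := fun _ _ h =>
  le_iInf₂ fun p hp => iInf₂_le p ⟨hp.1, (Nat.mono_cast h).trans hp.2⟩

section Dimension

variable {R : Type*} [CommRing R]

lemma le_supportDim_iff {L : Type*} [AddCommGroup L] [Module R L] {n : ℕ} :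
    (n : WithBot ℕ∞) ≤ Module.supportDim R L ↔
      ∃ s : LTSeries (PrimeSpectrum R), s.length = n ∧ s.head ∈ Module.support R L := by
  rw [Module.supportDim, Order.le_krullDim_iff]
  refine ⟨fun ⟨s, hs⟩ => ⟨s.map Subtype.val fun _ _ h => h, hs, s.head.2⟩, fun ⟨s, hs, h⟩ => ?_⟩
  exact ⟨⟨s.length, fun i => ⟨s i, Module.mem_support_mono (s.monotone (Fin.zero_le i)) h⟩,
    fun i => s.step i⟩, hs⟩

lemma le_ringKrullDim_quotient_iff {p : PrimeSpectrum R} {n : ℕ} :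
    (n : WithBot ℕ∞) ≤ ringKrullDim (R ⧸ p.asIdeal) ↔
      ∃ s : LTSeries (PrimeSpectrum R), s.length = n ∧ p ≤ s.head := by
  rw [← Module.supportDim_quotient_eq_ringKrullDim, le_supportDim_iff, Module.support_eq_zeroLocus,
    Ideal.annihilator_quotient]
  rfl

variable {L : Type*} [AddCommGroup L] [Module R L]

lemma supportDim_lt_iff {n : ℕ} : Module.supportDim R L < n ↔
    ∀ p : PrimeSpectrum R, n ≤ ringKrullDim (R ⧸ p.asIdeal) → p ∉ Module.support R L := by
  simp only [← not_le, le_supportDim_iff, le_ringKrullDim_quotient_iff]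
  exact ⟨fun h p ⟨s, hs, hps⟩ hp => h ⟨s, hs, Module.mem_support_mono hps hp⟩,
    fun h ⟨s, hs, hp⟩ => h s.head ⟨s, hs, le_rfl⟩ hp⟩

lemma isMaximal_of_supportDim_lt_two (h : Module.supportDim R L < 2) {p q : PrimeSpectrum R}
    (hp : p ∈ Module.support R L) (hpq : p < q) : q.asIdeal.IsMaximal := by
  by_contra not_isMaximal
  obtain ⟨m, hm, hle⟩ := Ideal.exists_le_maximal q.asIdeal q.isPrime.ne_top
  have hlt : q < ⟨m, hm.isPrime⟩ := lt_of_le_of_ne hle fun h => not_isMaximal (h ▸ hm)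
  let s : LTSeries (PrimeSpectrum R) := .mk 2 ![p, q, ⟨m, hm.isPrime⟩] (by simp [hpq, hlt])
  exact h.not_ge (le_supportDim_iff.2 ⟨s, rfl, hp⟩)

lemma supportDim_mono {L' : Type*} [AddCommGroup L'] [Module R L']
    (h : Module.support R L ⊆ Module.support R L') :
    Module.supportDim R L ≤ Module.supportDim R L' :=
  Order.krullDim_le_of_strictMono (Set.inclusion h) fun _ _ h => h

theorem exists_supportDim_pow_smul_lt [IsNoetherianRing R] {b : Ideal R} {n : ℕ}
    (hAss : {p : PrimeSpectrum R | IsAssociatedPrime p.asIdeal L}.Finite)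
    (h : ∀ p : PrimeSpectrum R, n ≤ ringKrullDim (R ⧸ p.asIdeal) →
      ∃ t : ℕ, p ∉ Module.support R ↥(b ^ t • (⊤ : Submodule R L))) :
    ∃ t : ℕ, Module.supportDim R ↥(b ^ t • (⊤ : Submodule R L)) < n := by
  choose! t ht using h
  refine ⟨hAss.toFinset.sup t, supportDim_lt_iff.2 fun p hp hmem => ?_⟩
  obtain ⟨q, hqp, hq⟩ := exists_isAssociatedPrime_le_of_mem_support hmem
  have hqL : IsAssociatedPrime q.asIdeal L :=
    hq.map_of_injective (Submodule.subtype _) (Submodule.subtype_injective _)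
  have le : b ^ hAss.toFinset.sup t • (⊤ : Submodule R L) ≤ b ^ t q • ⊤ :=
    Submodule.smul_mono_left (Ideal.pow_le_pow_right (Finset.le_sup (hAss.mem_toFinset.2 hqL)))
  exact ht q
    (hp.trans (ringKrullDim_le_of_surjective _ (Ideal.Quotient.factor_surjective hqp)))
    (Module.support_subset_of_injective _ (Submodule.inclusion_injective le)
      (mem_support_of_isAssociatedPrime hq))

end Dimension

section CofiniteLocalCohomology

variable {R : Type u} [CommRing R] [IsNoetherianRing R] {a : Ideal R}

lemma finite_extQuot_localCohomology_of_lt {M : Type u} [AddCommGroup M] [Module R M]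
    [Module.Finite R M] {i : ℕ}
    (h : ∀ j < i, ∀ k, Module.Finite R (extQuot a k (H a j M))) :
    Module.Finite R (extQuot a 0 (H a i M)) ∧ Module.Finite R (extQuot a 1 (H a i M)) := by
  cases i with
  | zero =>
    have := Module.Finite.equiv (localCohomologyZeroEquiv a M).symm
    exact ⟨inferInstance, inferInstance⟩
  | succ i =>
    have ext_succ := prop_ext_localCohomology_succ (P := ModuleCat.isFG R) (a := a) i M
      (fun k => inferInstanceAs (Module.Finite R (extQuot a (k + 2) (a.primaryComponent M))))
      fun j hj k => h (j + 1) (Nat.succ_lt_succ hj) k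
    exact ⟨ext_succ.1 (inferInstanceAs (Module.Finite R (extQuot a (i + 1) M))),
      ext_succ.2 (inferInstanceAs (Module.Finite R (extQuot a (i + 2) M)))⟩

theorem finite_extQuot_of_notMem_support_pow_smul {L : Type u} [AddCommGroup L] [Module R L]
    (htor : IsPowTorsion a L) (h₀ : Module.Finite R (extQuot a 0 L))
    (h₁ : Module.Finite R (extQuot a 1 L))
    (hsupp : ∀ p : PrimeSpectrum R, 2 ≤ ringKrullDim (R ⧸ p.asIdeal) →
      ∃ t : ℕ, p ∉ Module.support R ↥(a ^ t • (⊤ : Submodule R L))) (k : ℕ) :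
    Module.Finite R (extQuot a k L) := by
  have := finite_extQuot_zero_iff.1 h₀
  obtain ⟨t, ht⟩ := exists_supportDim_pow_smul_lt (n := 2) (finite_setOf_isAssociatedPrime htor)
    hsupp
  let W := Submodule.torsionBySet R L (a ^ t : Ideal R)
  have : Module.Finite R W := finite_torsionBySet_pow a t
  have finite_W (j : ℕ) : Module.Finite R (extQuot a j W) := inferInstance
  have exact_W := LinearMap.exact_subtype_mkQ W
  have finite_quotient {j : ℕ} (hj : Module.Finite R (extQuot a j L)) :
      Module.Finite R (extQuot a j (L ⧸ W)) :=
    prop_ext_right (P := ModuleCat.isFG R) W.subtype_injective exact_W W.mkQ_surjective j hj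
      (finite_W (j + 1))
  have supportDim_quotient_lt : Module.supportDim R (L ⧸ W) < 2 :=
    (supportDim_mono fun p => mem_support_of_mem_support_quotient_torsionBySet
      (IsNoetherian.noetherian (a ^ t))).trans_lt ht
  exact prop_ext_middle (P := ModuleCat.isFG R) W.subtype_injective exact_W W.mkQ_surjective k
    (finite_W k) (finite_extQuot_of_support (htor.of_surjective _ W.mkQ_surjective)
      (fun p hp q hpq => isMaximal_of_supportDim_lt_two supportDim_quotient_lt hp hpq)
      (finite_quotient h₀) (finite_quotient h₁) k)

variable {M : Type u} [AddCommGroup M] [Module R M] [Module.Finite R M]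

theorem finite_extQuot_localCohomology {i : ℕ} (hi : (i : ℕ∞) < nthFinitenessDim 2 a M) (k : ℕ) :
    Module.Finite R (extQuot a k (H a i M)) := by
  induction i using Nat.strong_induction_on generalizing k with | _ i ih
  obtain ⟨h₀, h₁⟩ := finite_extQuot_localCohomology_of_lt fun j hj =>
    ih j hj (hi.trans' (Nat.cast_lt.2 hj))
  exact finite_extQuot_of_notMem_support_pow_smul (isPowTorsion_localCohomology a i M) h₀ h₁
    (fun p hp => exists_notMem_support_pow_smul_localCohomology hi hp) k

theorem finite_setOf_isAssociatedPrime_localCohomology {i : ℕ}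
    (hi : (i : ℕ∞) ≤ nthFinitenessDim 2 a M) :
    {p : PrimeSpectrum R | IsAssociatedPrime p.asIdeal (H a i M)}.Finite := by
  have := finite_extQuot_zero_iff.1 (finite_extQuot_localCohomology_of_lt (i := i) (M := M)
    fun j hj => finite_extQuot_localCohomology (hi.trans_lt' (Nat.cast_lt.2 hj))).1
  exact finite_setOf_isAssociatedPrime (isPowTorsion_localCohomology a i M)

end CofiniteLocalCohomology

section LocalGlobalPrinciple

variable {R : Type u} [CommRing R] {L : Type*} [AddCommGroup L] [Module R L]

lemma supportDim_localizedModule_le (S : Submonoid R) :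
    Module.supportDim (Localization S) (LocalizedModule S L) ≤ Module.supportDim R L :=
  Order.krullDim_le_of_strictMono
    (fun Q => ⟨PrimeSpectrum.comap (algebraMap R (Localization S)) Q.1,
      mem_support_localizedModule_iff.1 Q.2⟩)
    (Monotone.strictMono_of_injective (fun _ _ h => Ideal.comap_mono h) fun _ _ h =>
      Subtype.ext (PrimeSpectrum.localization_comap_injective _ S (congrArg Subtype.val h)))

lemma length_le_supportDim_localizedModule {s : LTSeries (PrimeSpectrum R)}
    (hs : s.head ∈ Module.support R L) :
    s.length ≤ Module.supportDim (Localization.AtPrime s.last.asIdeal)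
      (LocalizedModule s.last.asIdeal.primeCompl L) := by
  let e := IsLocalization.AtPrime.primeSpectrumOrderIso
    (Localization.AtPrime s.last.asIdeal) s.last.asIdeal
  let s' : LTSeries (Set.Iic s.last) :=
    ⟨s.length, fun i => ⟨s i, s.monotone (Fin.le_last i)⟩, fun i => s.step i⟩
  refine le_supportDim_iff.2 ⟨s'.map e.symm e.symm.strictMono, rfl, ?_⟩
  have comap_head : PrimeSpectrum.comap (algebraMap R (Localization.AtPrime s.last.asIdeal))
      (e.symm s'.head) = s.head := congrArg Subtype.val (e.apply_symm_apply s'.head)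
  rw [LTSeries.head_map, mem_support_localizedModule_iff, comap_head]
  exact hs

theorem exists_supportDim_localized_pow_smul_lt_iff [IsNoetherianRing R] {b : Ideal R} {n : ℕ}
    (hAss : {p : PrimeSpectrum R | IsAssociatedPrime p.asIdeal L}.Finite) :
    (∀ p : PrimeSpectrum R, ∃ t : ℕ, Module.supportDim (Localization.AtPrime p.asIdeal)
        (LocalizedModule p.asIdeal.primeCompl ↥(b ^ t • (⊤ : Submodule R L))) < n) ↔
      ∃ t : ℕ, Module.supportDim R ↥(b ^ t • (⊤ : Submodule R L)) < n := by
  refine ⟨fun h => exists_supportDim_pow_smul_lt hAss fun p hp => ?_,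
    fun ⟨t, ht⟩ p => ⟨t, (supportDim_localizedModule_le _).trans_lt ht⟩⟩
  obtain ⟨s, rfl, hps⟩ := le_ringKrullDim_quotient_iff.1 hp
  obtain ⟨t, ht⟩ := h s.last
  exact ⟨t, fun hmem =>
    ht.not_ge (length_le_supportDim_localizedModule (Module.mem_support_mono hps hmem))⟩

/-- The finitely generated submodule in the definition is killed by a power of `b`. -/
lemma exists_inDimensionLT_pow_smul_iff {b : Ideal R} (htor : IsPowTorsion b L) {n : ℕ} :
    (∃ t : ℕ, InDimensionLT R ↥(b ^ t • (⊤ : Submodule R L)) n) ↔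
      ∃ t : ℕ, Module.supportDim R ↥(b ^ t • (⊤ : Submodule R L)) < n := by
  refine ⟨fun ⟨t, N, hN, hdim⟩ => ?_, fun ⟨t, ht⟩ => ⟨t, ⊥, Submodule.fg_bot, ?_⟩⟩
  · obtain ⟨s, hs⟩ := exists_pow_smul_eq_zero_of_fg hN fun z _ =>
      mem_primaryComponent_iff.2 (htor.of_injective _ (Submodule.subtype_injective _) z)
    refine ⟨s + t, (supportDim_mono fun p hp => ?_).trans_lt hdim⟩
    contrapose! hp
    rw [pow_add, ← smul_eq_mul, Submodule.smul_assoc]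
    refine notMem_support_smul fun x hx z hz => ?_
    obtain ⟨r, hr, smul_eq_zero⟩ := Module.notMem_support_iff'.1 hp (N.mkQ ⟨z, hz⟩)
    rw [← map_smul, Submodule.mkQ_apply, Submodule.Quotient.mk_eq_zero] at smul_eq_zero
    exact ⟨r, hr, (smul_comm r x z).trans (congrArg Subtype.val (hs x hx _ smul_eq_zero))⟩
  · rwa [Module.supportDim_eq_of_equiv (Submodule.quotEquivOfEqBot _ rfl)]

lemma supportDim_smul_top_congr {L' : Type*} [AddCommGroup L'] [Module R L'] (e : L ≃ₗ[R] L')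
    (c : Ideal R) : Module.supportDim R ↥(c • (⊤ : Submodule R L)) =
      Module.supportDim R ↥(c • (⊤ : Submodule R L')) :=
  Module.supportDim_eq_of_equiv (e.ofSubmodules _ _ (by
    rw [Submodule.map_smul'', Submodule.map_top, LinearEquiv.range]))

end LocalGlobalPrinciple

section HDim

variable {R : Type u} [CommRing R] {a b : Ideal R} {M : Type u} [AddCommGroup M] [Module R M]

lemma lt_hDim_iff (hba : b ≤ a) {n : ℕ} {r : ℕ∞} : r < hDim a b M n ↔
    r ≠ ⊤ ∧ ∀ i : ℕ, (i : ℕ∞) ≤ r → ∃ t : ℕ,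
      Module.supportDim R ↥(b ^ t • (⊤ : Submodule R (H a i M))) < n := by
  simp only [hDim, lt_iInf_natCast_iff, not_forall, not_not,
    exists_inDimensionLT_pow_smul_iff ((isPowTorsion_localCohomology a _ M).mono hba)]

lemma supportDim_pow_smul_localCohomology_locModule [IsNoetherianRing R] (a b : Ideal R) (i t : ℕ)
    (p : PrimeSpectrum R) :
    Module.supportDim (Localization.AtPrime p.asIdeal)
        ↥(locIdeal p b ^ t • (⊤ : Submodule (Localization.AtPrime p.asIdeal)
          (H (locIdeal p a) i (locModule p M)))) =
      Module.supportDim (Localization.AtPrime p.asIdeal)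
        (locModule p ↥(b ^ t • (⊤ : Submodule R (H a i M)))) := by
  obtain ⟨e⟩ := nonempty_localized_localCohomology_equiv p.asIdeal.primeCompl a i M
  rw [← supportDim_smul_top_congr e, ← Ideal.map_pow]
  exact Module.supportDim_eq_of_equiv (smulLocalizedEquiv _ _ _)

theorem forall_lt_hDim_locModule_iff [IsNoetherianRing R] [Nontrivial R] [Module.Finite R M]
    (hba : b ≤ a) {n : ℕ} {r : ℕ∞} (hr : r ≤ nthFinitenessDim 2 a M) :
    (∀ p : PrimeSpectrum R, r < hDim (locIdeal p a) (locIdeal p b) (locModule p M) n) ↔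
      r < hDim a b M n := by
  have local_global {i : ℕ} (hi : (i : ℕ∞) ≤ r) :=
    exists_supportDim_localized_pow_smul_lt_iff (b := b) (n := n)
      (finite_setOf_isAssociatedPrime_localCohomology (hi.trans hr))
  simp only [lt_hDim_iff hba, lt_hDim_iff (Ideal.map_mono hba),
    supportDim_pow_smul_localCohomology_locModule, forall_and, forall_const]
  refine and_congr_right fun _ => ?_
  rw [forall_comm]
  refine forall_congr' fun i => ?_
  rw [forall_comm]
  exact forall_congr' local_global

lemma bFinitenessDim_eq_hDim_zero [IsNoetherianRing R] (hba : b ≤ a) :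
    bFinitenessDim a b M = hDim a b M 0 := by
  have supportDim_lt_zero_iff (i t : ℕ) :
      Module.supportDim R ↥(b ^ t • (⊤ : Submodule R (H a i M))) < (0 : ℕ) ↔
        b ^ t ≤ Module.annihilator R (H a i M) := by
    rw [Nat.cast_zero, WithBot.lt_zero_iff_eq_bot, Module.supportDim_eq_bot_iff_subsingleton,
      Submodule.subsingleton_iff_eq_bot, ← Submodule.le_annihilator_iff, Submodule.annihilator_top]
  have le_radical_iff (i : ℕ) : b ≤ (Module.annihilator R (H a i M)).radical ↔
      ∃ t : ℕ, InDimensionLT R ↥(b ^ t • (⊤ : Submodule R (H a i M))) 0 := by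
    simp only [supportDim_lt_zero_iff,
      exists_inDimensionLT_pow_smul_iff ((isPowTorsion_localCohomology a i M).mono hba)]
    exact ⟨fun h => Ideal.exists_pow_le_of_le_radical_of_fg h (IsNoetherian.noetherian b),
      fun ⟨t, ht⟩ x hx => ⟨t, ht (Ideal.pow_mem_pow hx t)⟩⟩
  simp only [bFinitenessDim, hDim, le_radical_iff, not_exists]

lemma le_nthFinitenessDim_two [IsNoetherianRing R] [Module.Finite R M] {r : ℕ∞}
    (hr : r ∈ ({1, finitenessDim a M, nthFinitenessDim 1 a M, nthFinitenessDim 2 a M} : Set ℕ∞)) :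
    r ≤ nthFinitenessDim 2 a M := by
  rcases hr with rfl | rfl | rfl | rfl
  · exact one_le_finitenessDim.trans (finitenessDim_le_nthFinitenessDim 2)
  · exact finitenessDim_le_nthFinitenessDim 2
  · exact nthFinitenessDim_mono a M one_le_two
  · exact le_rfl

end HDim

end LocalGlobal

theorem corollary1p2_general {R : Type u} [CommRing R] [IsNoetherianRing R] [Nontrivial R]
    (M : Type u) [AddCommGroup M] [Module R M] [Module.Finite R M]
    {a b : Ideal R} (hba : b ≤ a) {r : ℕ∞} (hr : r ≤ nthFinitenessDim 2 a M) :
    (∀ n : ℕ,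
      ((∀ p : PrimeSpectrum R, r < hDim (locIdeal p a) (locIdeal p b) (locModule p M) n) ↔
        r < hDim a b M n)) ∧
    ((∀ p : PrimeSpectrum R,
        r < bFinitenessDim (locIdeal p a) (locIdeal p b) (locModule p M)) ↔
      r < bFinitenessDim a b M) := by
  refine ⟨fun n => forall_lt_hDim_locModule_iff hba hr, ?_⟩
  have (p : PrimeSpectrum R) : IsNoetherianRing (Localization.AtPrime p.asIdeal) :=
    IsLocalization.isNoetherianRing p.asIdeal.primeCompl _ inferInstance
  simp only [bFinitenessDim_eq_hDim_zero hba, bFinitenessDim_eq_hDim_zero (Ideal.map_mono hba)]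
  exact forall_lt_hDim_locModule_iff hba hr

theorem corollary1p2 {R : Type u} [CommRing R] [IsNoetherianRing R] [Nontrivial R]
    (M : Type u) [AddCommGroup M] [Module R M] [Module.Finite R M]
    (a b : Ideal R) (hba : b ≤ a) :
    (∀ n : ℕ, ∀ r ∈ ({1, finitenessDim a M, nthFinitenessDim 1 a M,
        nthFinitenessDim 2 a M} : Set ℕ∞),
      ((∀ p : PrimeSpectrum R, r < hDim (locIdeal p a) (locIdeal p b) (locModule p M) n) ↔
        r < hDim a b M n)) ∧
    (a • (⊤ : Submodule R M) ≠ ⊤ →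
      (∀ n : ℕ,
        ((∀ p : PrimeSpectrum R,
            gradeOn a M < hDim (locIdeal p a) (locIdeal p b) (locModule p M) n) ↔
          gradeOn a M < hDim a b M n)) ∧
      ((∀ p : PrimeSpectrum R,
          gradeOn a M < bFinitenessDim (locIdeal p a) (locIdeal p b) (locModule p M)) ↔
        gradeOn a M < bFinitenessDim a b M)) :=
  ⟨fun n _ hr => (corollary1p2_general M hba (le_nthFinitenessDim_two hr)).1 n, fun ha =>
    corollary1p2_general M hba
      ((gradeOn_le_finitenessDim ha).trans (finitenessDim_le_nthFinitenessDim 2))⟩
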